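/- **Setting.** Let $T,\alpha,M>0$. Let $\Omega\subset\mathbb R^2$ be a nonempty bounded convex open set. Let $A(x)$ ($x\in\Omega$) be a symmetric $2\times2$ matrix with $A(x)\xi\cdot\xi\ge\alpha|\xi|^2$ for all $\xi\in\mathbb R^2$, and let $B(x,t,s)$ ($x\in\Omega$, $0\le s\le t\le T$) be a $2\times 2$ matrix. The entries of $A$ and $B$ are continuously differentiable, and they and their first derivatives are bounded by $M$. Let $\overline\Omega=\bigcup_i K_i$ be a decomposition into finitely many nondegenerate closed triangles and rectangles with disjoint interiors (hanging nodes allowed), $h_i=\operatorname{diam}K_i$, and let $p_i\ge1$ be integers. $V_h$ is the space of functions that are on each triangle $K_i$ a polynomial of degree $\le p_i$ and on each rectangle $K_i$ a polynomial of degree $\le p_i$ in each of the two variables along the sides; $\mathbf W_h=V_h\times V_h$. $\Gamma_I$ is the union of the interior edges $\partial K_i\cap\partial K_j$ of positive length, $\Gamma=\Gamma_I\cup\partial\Omega$. On interior edges, with outward normals $\nu_i,\nu_j$, $[v]=v|_{K_i}\nu_i+v|_{K_j}\nu_j$, $[\mathbf w]=\mathbf w|_{K_i}\cdot\nu_i+\mathbf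 w|_{K_j}\cdot\nu_j$, $\{\mathbf w\}=\frac12(\mathbf w|_{K_i}+\mathbf w|_{K_j})$; on $\partial\Omega$, $[v]=v\nu$ and $\{\mathbf w\}=\mathbf w$. Let $\zeta>0$, $\kappa\ge0$, $-1\le a\le0\le b\le1$; $C_{11}=\zeta\min\{h_i^{a}p_i^{-2a},h_j^{a}p_j^{-2a}\}$ and $C_{22}=\kappa\min\{h_i^{b}p_i^{-2b},h_j^{b}p_j^{-2b}\}$ on the edge between $K_i$ and $K_j$, $C_{11}=\zeta h_i^{a}p_i^{-2a}$ on $\partial K_i\cap\partial\Omega$; and let $C_{12}$ be a bounded measurable $\mathbb R^2$-valued function on $\Gamma_I$, taken as $0$ on $\partial\Omega$. With $(\cdot,\cdot)$ and $\|\cdot\|$ the inner product and norm of $L^2(\Omega)$ or $L^2(\Omega)^2$, put $$\mathcal A(\mathbf p,\mathbf w)=\int_\Omega\mathbf p\cdot\mathbf w\,dx,\quad \mathcal A_2(\mathbf p,\mathbf w)=\int_\Omega A\mathbf p\cdot\mathbf w\,dx,\quad \mathcal B(t,s;\mathbf p,\mathbf w)=\int_\Omega B(\cdot,t,s)\mathbf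 p\cdot\mathbf w\,dx,$$ $$\mathcal A_1(v,\mathbf p)=\sum_i\int_{K_i}\mathbf p\cdot\nabla v\,dx-\int_\Gamma(\{\mathbf p\}-C_{12}[\mathbf p])\cdot[v]\,ds,$$ $$J_1(\mathbf p,\mathbf w)=\int_{\Gamma_I}C_{22}[\mathbf p][\mathbf w]\,ds,\quad J(\phi,v)=\int_\Gamma C_{11}[\phi]\cdot[v]\,ds.$$ Let $k=T/N$ with a positive integer $N$, $t_r=rk$. For a sequence $(\phi^n)$ put $\phi^{n+1/2}=\frac12(\phi^{n+1}+\phi^n)$, $\phi^{n;1/4}=\frac14(\phi^{n+1}+2\phi^n+\phi^{n-1})$, $\partial_t\phi^{n+1/2}=(\phi^{n+1}-\phi^n)/k$, $\partial_t^2\phi^n=(\phi^{n+1}-2\phi^n+\phi^{n-1})/k^2$. Let $f(\cdot,t)\in L^2(\Omega)$ for $t\in[0,T]$, $f^n=f(\cdot,t_n)$, and let $F^n$, $G^n$ be linear functionals on $V_h$, $\mathbf W_h$, with $G^0=0$ and norms $\|F^n\|=\sup_{\chi\in V_h\setminus\{0\}}|F^n(\chi)|/\|\chi\|$, and likewise for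 functionals on $\mathbf W_h$. Let $\Phi^n=(U^n,\mathbf Q^n,\mathbf Z^n)\in V_h\times\mathbf W_h\times\mathbf W_h$ ($0\le n\le N$) satisfy, for all $v\in V_h$ and $\mathbf w,\boldsymbol\tau\in\mathbf W_h$, $$\mathcal A(\mathbf Q^{n+1/2},\mathbf w)-\mathcal A_1(U^{n+1/2},\mathbf w)+J_1(\mathbf Z^{n+1/2},\mathbf w)=0\qquad(0\le n<N),$$ $$\mathcal A_2(\mathbf Q^{n+1/2},\boldsymbol\tau)-\mathcal A(\mathbf Z^{n+1/2},\boldsymbol\tau)+\tfrac12\big(E^{n+1}(\boldsymbol\tau)+E^n(\boldsymbol\tau)\big)=G^{n+1/2}(\boldsymbol\tau)\qquad(0\le n<N),$$ $$(\partial_t^2U^n,v)+\mathcal A_1(v,\mathbf Z^{n;1/4})+J(U^{n;1/4},v)=(f^{n;1/4},v)+F^n(v)\qquad(1\le n<N),$$ where $E^n(\boldsymbol\tau)=k\sum_{j=0}^{n-1}\mathcal B(t_n,t_{j+1/2};\mathbf Q^{j+1/2},\boldsymbol\tau)$. Define $$|||\Phi^{n+1/2}|||^2=\|\partial_tU^{n+1/2}\|^2+\|A^{1/2}\mathbf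 Q^{n+1/2}\|^2+J_1(\mathbf Z^{n+1/2},\mathbf Z^{n+1/2})+J(U^{n+1/2},U^{n+1/2}).$$ **Theorem.** There are positive constants $C$ and $k_0$, depending only on $T$, $\alpha$ and $M$, such that, in the above setting, if $k\le k_0$, then for every $m\ge1$ with $t_{m+1}\le T$ $$|||\Phi^{m+1/2}|||\le C\Big(|||\Phi^{1/2}|||+k\sum_{n=0}^{m+1}\|f^n\|+k\sum_{n=1}^m\|F^n\|+k\sum_{n=0}^m\|\partial_tG^{n+1/2}\|\Big).$$ -/

import Mathlib

open MeasureTheory MvPolynomial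
open scoped Matrix RealInnerProductSpace

noncomputable section

namespace DGWave

/-- The Euclidean plane. -/
abbrev Plane : Type := EuclideanSpace ℝ (Fin 2)

/-- The determinant of the pair `(u, v)`. -/
def cross (u v : Plane) : ℝ := u 0 * v 1 - u 1 * v 0

/-! ### Triangles, rectangles and triangulations -/

/-- A mesh cell: a nondegenerate triangle with vertices `a`, `b`, `c`, or a nondegenerate rectangle
with corner `a` and orthogonal side vectors `u`, `v` (not necessarily parallel to the axes). The
vertices are listed counterclockwise, which is no restriction on the underlying set. -/
inductive Cell : Type
  | triangle (a b c : Plane) (pos : 0 < cross (b - a) (c - a))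
  | rectangle (a u v : Plane) (orth : ⟪u, v⟫ = 0) (pos : 0 < cross u v)

namespace Cell

/-- The number of sides (and of vertices). -/
def numSides : Cell → ℕ
  | triangle _ _ _ _ => 3
  | rectangle _ _ _ _ _ => 4

/-- The vertices in counterclockwise order. -/
def vertex : (K : Cell) → Fin K.numSides → Plane
  | triangle a b c _ => ![a, b, c]
  | rectangle a u v _ _ => ![a, a + u, a + u + v, a + v]

/-- The counterclockwise successor of each vertex. -/
def nextVertex : (K : Cell) → Fin K.numSides → Plane
  | triangle a b c _ => ![b, c, a]
  | rectangle a u v _ _ => ![a + u, a + u + v, a + v, a]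

/-- The closed cell as a subset of the plane. -/
def carrier (K : Cell) : Set Plane := convexHull ℝ (Set.range K.vertex)

/-- The side vector from a vertex to the next one. -/
def sideVec (K : Cell) (s : Fin K.numSides) : Plane := K.nextVertex s - K.vertex s

/-- The sides: the segments that join cyclically consecutive vertices. -/
def side (K : Cell) (s : Fin K.numSides) : Set Plane :=
  segment ℝ (K.vertex s) (K.nextVertex s)

/-- The outward unit normal on a side: the unit side vector, turned by a right angle clockwise. -/
def normal (K : Cell) (s : Fin K.numSides) : Plane :=
  ‖K.sideVec s‖⁻¹ • !₂[K.sideVec s 1, -(K.sideVec s 0)]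

/-- The local polynomial space of order `p`: the polynomials of total degree at most `p` on a
triangle; on a rectangle, the polynomials of degree at most `p` in each of the two variables
`⟪u, x⟫`, `⟪v, x⟫` along the sides (for a rectangle that is parallel to the axes, in each of
`x 0`, `x 1`). -/
def polySpace : Cell → ℕ → Submodule ℝ (MvPolynomial (Fin 2) ℝ)
  | triangle _ _ _ _, p => restrictTotalDegree (Fin 2) ℝ p
  | rectangle _ u v _ _, p =>
      (restrictDegree (Fin 2) ℝ p).map
        (aeval (R := ℝ) (fun j : Fin 2 => ∑ i, C ((![u, v] : Fin 2 → Plane) j i) * X i)).toLinearMap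

end Cell

/-- A triangulation of `Ω` into finitely many triangles and rectangles with pairwise disjoint
interiors. Hanging nodes are allowed. -/
structure Mesh (Ω : Set Plane) where
  /-- the number of cells -/
  numCells : ℕ
  /-- the cells -/
  cell : Fin numCells → Cell
  iUnion_carrier : ⋃ i, (cell i).carrier = closure Ω
  disjoint_interior : ∀ i j, i ≠ j →
    Disjoint (interior (cell i).carrier) (interior (cell j).carrier)

/-- A discontinuous Galerkin discretization: a triangulation, local polynomial degrees, and the
parameters of the numerical fluxes. The exponents are `a` (for `C₁₁`) and `b` (for `C₂₂`). -/
structure Discretization (Ω : Set Plane) extends Mesh Ω where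
  /-- the local polynomial degrees -/
  deg : Fin numCells → ℕ
  one_le_deg : ∀ i, 1 ≤ deg i
  /-- the factor of `C₁₁` -/
  ζ : ℝ
  zeta_pos : 0 < ζ
  /-- the factor of `C₂₂` -/
  κ : ℝ
  kappa_nonneg : 0 ≤ κ
  /-- the exponent of `C₁₁` -/
  a : ℝ
  a_mem : a ∈ Set.Icc (-1 : ℝ) 0
  /-- the exponent of `C₂₂` -/
  b : ℝ
  b_mem : b ∈ Set.Icc (0 : ℝ) 1
  /-- the vector-valued flux parameter `C₁₂`, used on the interior edges -/
  C12 : Plane → Plane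
  measurable_C12 : Measurable C12
  bounded_C12 : ∃ c, ∀ x, ‖C12 x‖ ≤ c

namespace Discretization

variable {Ω : Set Plane} (D : Discretization Ω)

/-! ### The finite element spaces -/

/-- Broken polynomials: one polynomial for each cell. As the cells have nonempty interior, this is
the same as a class of functions in `L²(Ω)` that are polynomials on each cell. -/
abbrev Broken : Type := Fin D.numCells → MvPolynomial (Fin 2) ℝ

/-- The scalar finite element space `V_h`. -/
def V : Submodule ℝ D.Broken :=
  Submodule.pi Set.univ fun i => (D.cell i).polySpace (D.deg i)

/-- The vector finite element space `W_h = V_h × V_h`; the first index is the component. -/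
def W : Submodule ℝ (Fin 2 → D.Broken) := Submodule.pi Set.univ fun _ => D.V

/-- The function on the plane given by a broken polynomial (set to `0` outside the open cells). -/
def val (v : D.Broken) (x : Plane) : ℝ :=
  ∑ i, (interior (D.cell i).carrier).indicator (fun y => eval (fun c => y c) (v i)) x

/-- The vector field given by a broken polynomial vector field. -/
def vecVal (w : Fin 2 → D.Broken) (x : Plane) : Fin 2 → ℝ := fun c => D.val (w c) x

/-- The trace on `∂K_i` of `v` from inside `K_i`. -/
def tr (v : D.Broken) (i : Fin D.numCells) (x : Plane) : ℝ := eval (fun c => x c) (v i)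

/-- The trace on `∂K_i` of the vector field `w` from inside `K_i`. -/
def vecTr (w : Fin 2 → D.Broken) (i : Fin D.numCells) (x : Plane) : Plane :=
  !₂[D.tr (w 0) i x, D.tr (w 1) i x]

/-! ### Edges, jumps, averages -/

/-- The sides of all cells. -/
abbrev Side : Type := Σ i : Fin D.numCells, Fin (D.cell i).numSides

/-- The segment underlying a side. -/
def seg (e : D.Side) : Set Plane := (D.cell e.1).side e.2

/-- The outward unit normal of the cell on one of its sides. -/
def nu (e : D.Side) : Plane := (D.cell e.1).normal e.2

/-- `∫_{Γ_I}`: the integral over all interior edges `∂K_i ∩ ∂K_j`, `i < j`, with respect to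
arc length. Each such edge is split into the intersections of a side of `K_i` and a side of `K_j`;
intersections of zero length do not contribute. -/
def intInterior (φ : D.Side → D.Side → Plane → ℝ) : ℝ :=
  ∑ e : D.Side, ∑ e' : D.Side,
    if e.1 < e'.1 then ∫ x in D.seg e ∩ D.seg e', φ e e' x ∂(Measure.hausdorffMeasure 1) else 0

/-- `∫_{Γ_∂}`: the integral over all boundary edges `∂K_i ∩ ∂Ω`. -/
def intBoundary (φ : D.Side → Plane → ℝ) : ℝ :=
  ∑ e : D.Side, ∫ x in D.seg e ∩ frontier Ω, φ e x ∂(Measure.hausdorffMeasure 1)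

/-- The jump of a scalar function on an interior edge. -/
def jump (v : D.Broken) (e e' : D.Side) (x : Plane) : Plane :=
  D.tr v e.1 x • D.nu e + D.tr v e'.1 x • D.nu e'

/-- The jump of a vector field on an interior edge. -/
def vecJump (w : Fin 2 → D.Broken) (e e' : D.Side) (x : Plane) : ℝ :=
  ⟪D.vecTr w e.1 x, D.nu e⟫ + ⟪D.vecTr w e'.1 x, D.nu e'⟫

/-- The average of a vector field on an interior edge. -/
def vecAvg (w : Fin 2 → D.Broken) (e e' : D.Side) (x : Plane) : Plane :=
  (1 / 2 : ℝ) • (D.vecTr w e.1 x + D.vecTr w e'.1 x)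

/-- The jump of a scalar function on a boundary edge. -/
def bdryJump (v : D.Broken) (e : D.Side) (x : Plane) : Plane := D.tr v e.1 x • D.nu e

/-- The diameter of a cell. -/
def h (i : Fin D.numCells) : ℝ := Metric.diam (D.cell i).carrier

/-- `C₁₁` on the edge between `K_i` and `K_j`. -/
def C11 (i j : Fin D.numCells) : ℝ :=
  D.ζ * min (D.h i ^ D.a / (D.deg i : ℝ) ^ (2 * D.a)) (D.h j ^ D.a / (D.deg j : ℝ) ^ (2 * D.a))

/-- `C₁₁` on `∂K_i ∩ ∂Ω`. -/
def bdryC11 (i : Fin D.numCells) : ℝ := D.ζ * (D.h i ^ D.a / (D.deg i : ℝ) ^ (2 * D.a))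

/-- `C₂₂` on the edge between `K_i` and `K_j`. -/
def C22 (i j : Fin D.numCells) : ℝ :=
  D.κ * min (D.h i ^ D.b / (D.deg i : ℝ) ^ (2 * D.b)) (D.h j ^ D.b / (D.deg j : ℝ) ^ (2 * D.b))

/-! ### The bilinear forms -/

/-- The `L²(Ω)` inner product of a function and a broken polynomial. -/
def l2Inner (g : Plane → ℝ) (v : D.Broken) : ℝ := ∫ x in Ω, g x * D.val v x

/-- `∫_Ω S(x) p · w dx` for a matrix field `S`. -/
def weighted (S : Plane → Matrix (Fin 2) (Fin 2) ℝ) (p w : Fin 2 → D.Broken) : ℝ :=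
  ∫ x in Ω, (S x *ᵥ D.vecVal p x) ⬝ᵥ D.vecVal w x

/-- `𝒜(p, w) = ∫_Ω p · w dx`. -/
def formA (p w : Fin 2 → D.Broken) : ℝ := ∫ x in Ω, D.vecVal p x ⬝ᵥ D.vecVal w x

/-- `𝒜₁(v, p) = ∑ᵢ ∫_{K_i} p · ∇v dx - ∫_Γ ({p} - C₁₂ [p]) · [v] ds`, where `C₁₂` is present on
interior edges only, as in the numerical fluxes. -/
def formA1 (v : D.Broken) (p : Fin 2 → D.Broken) : ℝ :=
  (∑ i, ∫ x in (D.cell i).carrier, ∑ c, eval (fun c => x c) (p c i * pderiv c (v i)))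
    - (D.intInterior fun e e' x =>
        ⟪D.vecAvg p e e' x - D.vecJump p e e' x • D.C12 x, D.jump v e e' x⟫)
    - (D.intBoundary fun e x => ⟪D.vecTr p e.1 x, D.bdryJump v e x⟫)

/-- `J₁(p, w) = ∫_{Γ_I} C₂₂ [p] [w] ds`. -/
def formJ1 (p w : Fin 2 → D.Broken) : ℝ :=
  D.intInterior fun e e' x => D.C22 e.1 e'.1 * (D.vecJump p e e' x * D.vecJump w e e' x)

/-- `J(φ, v) = ∫_Γ C₁₁ [φ] · [v] ds`. -/
def formJ (φ v : D.Broken) : ℝ :=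
  (D.intInterior fun e e' x => D.C11 e.1 e'.1 * ⟪D.jump φ e e' x, D.jump v e e' x⟫)
    + D.intBoundary fun e x => D.bdryC11 e.1 * ⟪D.bdryJump φ e x, D.bdryJump v e x⟫

/-! ### Norms -/

/-- The `L²(Ω)` norm on `V_h`. -/
def normV (v : D.Broken) : ℝ := √(D.l2Inner (D.val v) v)

/-- The `L²(Ω)²` norm on `W_h`. -/
def normW (w : Fin 2 → D.Broken) : ℝ := √(D.formA w w)

/-- The norm of a linear functional on `V_h`. -/
def dualNormV (F : D.V →ₗ[ℝ] ℝ) : ℝ := ⨆ χ : {χ : D.V // χ ≠ 0}, |F χ| / D.normV (χ : D.V)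

/-- The norm of a linear functional on `W_h`. -/
def dualNormW (G : D.W →ₗ[ℝ] ℝ) : ℝ := ⨆ χ : {χ : D.W // χ ≠ 0}, |G χ| / D.normW (χ : D.W)

end Discretization

/-- The `L²(Ω)` norm of a function. -/
def l2Norm (Ω : Set Plane) (g : Plane → ℝ) : ℝ := √(∫ x in Ω, g x ^ 2)

/-! ### The coefficients -/

/-- The domain of definition of the memory coefficient: `x ∈ Ω`, `0 ≤ s ≤ t ≤ T`;
a point is `(x, t, s)`. -/
def memDomain (Ω : Set Plane) (T : ℝ) : Set (Plane × ℝ × ℝ) :=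
  {z | z.1 ∈ Ω ∧ 0 ≤ z.2.2 ∧ z.2.2 ≤ z.2.1 ∧ z.2.1 ≤ T}

/-- The assumptions on the coefficients: `A` is symmetric and uniformly positive definite with
constant `α`; the entries of `A` and `B` are continuously differentiable, and they and their first
derivatives are bounded by `M`. -/
structure CoeffBounds (Ω : Set Plane) (T α M : ℝ) (A : Plane → Matrix (Fin 2) (Fin 2) ℝ)
    (B : Plane → ℝ → ℝ → Matrix (Fin 2) (Fin 2) ℝ) : Prop where
  symm : ∀ x ∈ Ω, (A x).IsSymm
  coercive : ∀ x ∈ Ω, ∀ ξ : Fin 2 → ℝ, α * (ξ ⬝ᵥ ξ) ≤ (A x *ᵥ ξ) ⬝ᵥ ξ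
  contDiffOn_A : ∀ i j, ContDiffOn ℝ 1 (fun x => A x i j) Ω
  bound_A : ∀ i j, ∀ x ∈ Ω, |A x i j| ≤ M
  bound_deriv_A : ∀ i j, ∀ x ∈ Ω, ‖fderivWithin ℝ (fun x => A x i j) Ω x‖ ≤ M
  contDiffOn_B : ∀ i j,
    ContDiffOn ℝ 1 (fun z : Plane × ℝ × ℝ => B z.1 z.2.1 z.2.2 i j) (memDomain Ω T)
  bound_B : ∀ i j, ∀ z ∈ memDomain Ω T, |B z.1 z.2.1 z.2.2 i j| ≤ M
  bound_deriv_B : ∀ i j, ∀ z ∈ memDomain Ω T,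
    ‖fderivWithin ℝ (fun z : Plane × ℝ × ℝ => B z.1 z.2.1 z.2.2 i j) (memDomain Ω T) z‖ ≤ M

/-! ### Time discretization -/

section Time

variable {X : Type*} [AddCommGroup X] [Module ℝ X]

/-- `φ^{n+1/2} = (φ^{n+1} + φ^n) / 2`. -/
def half (φ : ℕ → X) (n : ℕ) : X := (1 / 2 : ℝ) • (φ (n + 1) + φ n)

/-- `φ^{n;1/4} = (φ^{n+1} + 2 φ^n + φ^{n-1}) / 4`, for `n ≥ 1`. -/
def quarter (φ : ℕ → X) (n : ℕ) : X := (1 / 4 : ℝ) • (φ (n + 1) + (2 : ℝ) • φ n + φ (n - 1))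

/-- `∂_t φ^{n+1/2} = (φ^{n+1} - φ^n) / k`. -/
def dt (k : ℝ) (φ : ℕ → X) (n : ℕ) : X := k⁻¹ • (φ (n + 1) - φ n)

/-- `∂_t² φ^n = (∂_t φ^{n+1/2} - ∂_t φ^{n-1/2}) / k`, for `n ≥ 1`. -/
def dt2 (k : ℝ) (φ : ℕ → X) (n : ℕ) : X := k⁻¹ • (dt k φ n - dt k φ (n - 1))

end Time

namespace Discretization

variable {Ω : Set Plane} (D : Discretization Ω)

/-- The quadrature `k ∑_{j < n} ℬ(t_n, t_{j+1/2}; Q^{j+1/2}, τ)` of the memory term at `t_n`, where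
`ℬ(t, s; p, w) = ∫_Ω B(x, t, s) p · w dx` and `t_r = r k`. -/
def memory (B : Plane → ℝ → ℝ → Matrix (Fin 2) (Fin 2) ℝ) (k : ℝ) (Q : ℕ → D.W)
    (τ : Fin 2 → D.Broken) (n : ℕ) : ℝ :=
  k * ∑ j ∈ Finset.range n,
    D.weighted (fun x => B x (n * k) ((j + 1 / 2) * k)) (half Q j : D.W) τ

/-- The perturbed fully discrete scheme with `N` steps of length `k`; `f n` is the source at the
time `n k`, and `F n`, `G n` are the perturbing functionals. -/
structure IsSolution (A : Plane → Matrix (Fin 2) (Fin 2) ℝ)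
    (B : Plane → ℝ → ℝ → Matrix (Fin 2) (Fin 2) ℝ) (k : ℝ) (N : ℕ) (f : ℕ → Plane → ℝ)
    (F : ℕ → D.V →ₗ[ℝ] ℝ) (G : ℕ → D.W →ₗ[ℝ] ℝ)
    (U : ℕ → D.V) (Q Z : ℕ → D.W) : Prop where
  gradient_eq : ∀ n < N, ∀ w : D.W,
    D.formA (half Q n : D.W) w - D.formA1 (half U n : D.V) w + D.formJ1 (half Z n : D.W) w = 0
  flux_eq : ∀ n < N, ∀ τ : D.W,
    D.weighted A (half Q n : D.W) τ - D.formA (half Z n : D.W) τ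
      + half (D.memory B k Q τ) n = half G n τ
  motion_eq : ∀ n, 1 ≤ n → n < N → ∀ v : D.V,
    D.l2Inner (D.val (dt2 k U n : D.V)) v + D.formA1 v (quarter Z n : D.W)
      + D.formJ (quarter U n : D.V) v = D.l2Inner (quarter f n) v + F n v

/-- The discrete energy norm of `(U, Q, Z)` at the level `n + 1/2`. As `A^{1/2}` is symmetric, the
term `‖A^{1/2} Q^{n+1/2}‖²` is `∫_Ω A Q^{n+1/2} · Q^{n+1/2} dx`. -/
def energyNorm (A : Plane → Matrix (Fin 2) (Fin 2) ℝ) (k : ℝ)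
    (U : ℕ → D.V) (Q Z : ℕ → D.W) (n : ℕ) : ℝ :=
  √(D.normV (dt k U n : D.V) ^ 2 + D.weighted A (half Q n : D.W) (half Q n : D.W)
    + D.formJ1 (half Z n : D.W) (half Z n : D.W) + D.formJ (half U n : D.V) (half U n : D.V))

end Discretization

end DGWave

end

/-! The estimate is a discrete energy identity followed by a Gronwall argument. Let δU and δQ be the
increments of `U` and `Q` between consecutive half levels. Since δU is `k` times the mean of two
consecutive difference quotients, testing the equation of motion with δU turns the inertia term, and
likewise the `J` term, into half the increment of a square. The term 𝒜₁(δU, Z^{n;1/4}) is traded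
twice. The difference of two consecutive gradient equations, tested with Z^{n;1/4}, turns it into
half the increment of the `J₁` square plus 𝒜(δQ, Z^{n;1/4}). The mean of the two flux equations,
tested with δQ, turns this last term into half the increment of the `A`-weighted square plus data.
Thus 𝒜₁ cancels exactly (`energy_step`). No quantitative property of it enters, so the constants do
not see the mesh, the degrees or the flux parameters.

The sources are paired with δU and so carry a factor `k`. The perturbation H = G - E of the flux
equation is paired with δQ, for which the energy gives no factor `k`. Summation by parts therefore
moves the difference onto H (`abs_sum_half_apply_le`). This is affordable because H⁰ = 0 and E^{n+1}
- E^n is of order `k` in the past values of `Q` (`abs_memory_succ_sub_le`).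

Every term on the right is then at most a linear quantity times the running maximum of the energy
norm. Dividing by that maximum and absorbing the newest summand, which requires `k` to be small,
leaves a linear Gronwall inequality (`le_of_sq_le_running_max`).

The abstract result is `energy_stability`. To apply it, the concrete forms must be bilinear, which
is a matter of integrability, and the dual norms must really bound the functionals. The latter holds
because the `L²` form is definite on the finite-dimensional spaces. -/

namespace DGWave

/-! ### Algebra of time averages and difference quotients -/

section Algebra

variable {X : Type*} [AddCommGroup X] [Module ℝ X]

theorem quarter_succ_eq_half (φ : ℕ → X) (i : ℕ) :
    quarter φ (i + 1) = (1 / 2 : ℝ) • (half φ (i + 1) + half φ i) := by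
  simp only [quarter, half, Nat.add_sub_cancel]
  module

theorem half_succ_sub_half {k : ℝ} (hk : k ≠ 0) (φ : ℕ → X) (i : ℕ) :
    half φ (i + 1) - half φ i = (k / 2) • (dt k φ (i + 1) + dt k φ i) := by
  simp only [half, dt, ← smul_add, smul_smul]
  rw [show k / 2 * k⁻¹ = 1 / 2 by field_simp]
  module

end Algebra

/-! ### The abstract scheme: energy identity, summation by parts, Gronwall -/

section Energy

variable {V W : Type*} [AddCommGroup V] [Module ℝ V] [AddCommGroup W] [Module ℝ W]

/-- One step of the energy identity of the mixed leapfrog scheme. -/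
theorem energy_step (l j : V →ₗ[ℝ] V →ₗ[ℝ] ℝ) (a a₂ j₁ : W →ₗ[ℝ] W →ₗ[ℝ] ℝ)
    (a₁ : V →ₗ[ℝ] W →ₗ[ℝ] ℝ)
    (hl : ∀ x y, l x y = l y x) (hj : ∀ x y, j x y = j y x) (ha : ∀ x y, a x y = a y x)
    (ha₂ : ∀ x y, a₂ x y = a₂ y x) (hj₁ : ∀ x y, j₁ x y = j₁ y x)
    {k : ℝ} (hk : k ≠ 0) (u : ℕ → V) (q z : ℕ → W) (P P' : W →ₗ[ℝ] ℝ) (R : V →ₗ[ℝ] ℝ) (i : ℕ)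
    (h₁ : ∀ w, a (half q i) w - a₁ (half u i) w + j₁ (half z i) w = 0)
    (h₁' : ∀ w, a (half q (i + 1)) w - a₁ (half u (i + 1)) w + j₁ (half z (i + 1)) w = 0)
    (h₂ : ∀ τ, a₂ (half q i) τ - a (half z i) τ = P τ)
    (h₂' : ∀ τ, a₂ (half q (i + 1)) τ - a (half z (i + 1)) τ = P' τ)
    (h₃ : ∀ v, l (dt2 k u (i + 1)) v + a₁ v (quarter z (i + 1)) + j (quarter u (i + 1)) v = R v) :
    (l (dt k u (i + 1)) (dt k u (i + 1)) + a₂ (half q (i + 1)) (half q (i + 1))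
        + j₁ (half z (i + 1)) (half z (i + 1)) + j (half u (i + 1)) (half u (i + 1)))
      - (l (dt k u i) (dt k u i) + a₂ (half q i) (half q i)
        + j₁ (half z i) (half z i) + j (half u i) (half u i))
      = 2 * (R (half u (i + 1) - half u i)
        + (1 / 2) * (P' (half q (i + 1) - half q i) + P (half q (i + 1) - half q i))) := by
  have e₃ := h₃ (half u (i + 1) - half u i)
  have e₁ := h₁ (quarter z (i + 1))
  have e₁' := h₁' (quarter z (i + 1))
  have e₂ := h₂ (half q (i + 1) - half q i)
  have e₂' := h₂' (half q (i + 1) - half q i)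
  -- With d₀, d₁ the two difference quotients, this pairs (d₁ - d₀)/k with (k/2)(d₁ + d₀): a
  -- difference of squares by symmetry.
  have el : l (dt2 k u (i + 1)) (half u (i + 1) - half u i)
      = 1 / 2 * (l (dt k u (i + 1)) (dt k u (i + 1)) - l (dt k u i) (dt k u i)) := by
    rw [half_succ_sub_half hk, dt2, Nat.add_sub_cancel]
    simp only [map_smul, map_add, map_sub, LinearMap.smul_apply, LinearMap.sub_apply,
      smul_eq_mul]
    rw [hl (dt k u i) (dt k u (i + 1))]
    field_simp
    ring
  rw [el] at e₃
  rw [quarter_succ_eq_half] at e₁ e₁' e₃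
  rw [quarter_succ_eq_half] at e₃
  generalize half u (i + 1) = u₁ at *
  generalize half u i = u₀ at *
  generalize half q (i + 1) = q₁ at *
  generalize half q i = q₀ at *
  generalize half z (i + 1) = z₁ at *
  generalize half z i = z₀ at *
  rw [← e₂, ← e₂', ← e₃]
  simp only [map_smul, map_add, map_sub, LinearMap.smul_apply, LinearMap.sub_apply,
    LinearMap.add_apply, smul_eq_mul] at *
  rw [hj u₀ u₁, ha₂ q₀ q₁, ha z₁ q₁, ha z₁ q₀, ha z₀ q₁, ha z₀ q₀]
  rw [hj₁ z₀ z₁] at e₁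
  -- The squares of `l`, `a₂`, `j` are already accounted for. The difference of the gradient
  -- equations, both tested with the averaged `z`, eliminates `a₁` and the mixed `a` terms and
  -- supplies the `j₁` square.
  linear_combination 2 * e₁' - 2 * e₁

/-- Summation by parts against slowly varying functionals. -/
theorem abs_sum_half_apply_le (H : ℕ → W →ₗ[ℝ] ℝ) (nW : W → ℝ) (d : ℕ → ℝ) (q : ℕ → W) (m : ℕ)
    (X : ℝ) (hd : ∀ n, 0 ≤ d n) (h0 : H 0 = 0)
    (hH : ∀ n ≤ m, ∀ τ, |H (n + 1) τ - H n τ| ≤ d n * nW τ) (hX : ∀ n ≤ m, nW (q n) ≤ X)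
    (hX0 : 0 ≤ X) :
    |∑ i ∈ Finset.range m, (1 / 2) * (half H (i + 1) (q (i + 1) - q i)
        + half H i (q (i + 1) - q i))| ≤ 3 * (∑ n ∈ Finset.range (m + 1), d n) * X := by
  have hbd : ∀ n ≤ m, ∀ l ≤ m, |H (n + 1) (q l) - H n (q l)| ≤ d n * X := fun n hn l hl =>
    (hH n hn _).trans (mul_le_mul_of_nonneg_left (hX l hl) (hd n))
  -- Since `H 0 = 0`, bounds on the increments telescope to bounds on the values.
  have hval : ∀ n ≤ m + 1, ∀ l ≤ m, |H n (q l)| ≤ (∑ i ∈ Finset.range n, d i) * X := by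
    intro n
    induction n with
    | zero => intro _ l _; simp [h0]
    | succ n ih =>
      intro hn l hl
      have h1 := ih (by omega) l hl
      have h2 := hbd n (by omega) l hl
      rw [Finset.sum_range_succ, add_mul]
      calc |H (n + 1) (q l)| = |H n (q l) + (H (n + 1) (q l) - H n (q l))| := by ring_nf
        _ ≤ _ := (abs_add_le _ _).trans (add_le_add h1 h2)
  set S : ℝ := ∑ n ∈ Finset.range (m + 1), d n with hS
  have hval' : ∀ n ≤ m + 1, ∀ l ≤ m, |H n (q l)| ≤ S * X := fun n hn l hl =>
    (hval n hn l hl).trans (mul_le_mul_of_nonneg_right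
      (Finset.sum_le_sum_of_subset_of_nonneg (Finset.range_mono hn) fun _ _ _ => hd _) hX0)
  -- the functional `L n` and its Abel transform
  set L : ℕ → W →ₗ[ℝ] ℝ := fun i => (1 / 2 : ℝ) • (half H (i + 1) + half H i) with hL
  have key : ∀ n, ∑ i ∈ Finset.range n, L i (q (i + 1) - q i)
      = L n (q n) - L 0 (q 0) - ∑ i ∈ Finset.range n, (L (i + 1) - L i) (q (i + 1)) := by
    intro n
    induction n with
    | zero => simp
    | succ n ih =>
      rw [Finset.sum_range_succ, Finset.sum_range_succ, ih]
      simp only [map_sub, LinearMap.sub_apply]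
      ring
  rcases Nat.eq_zero_or_pos m with rfl | hm
  · simp only [Finset.range_zero, Finset.sum_empty, abs_zero]
    have : 0 ≤ S := Finset.sum_nonneg fun _ _ => hd _
    positivity
  -- `L i` involves `H` up to index `i + 2`, and `H` is controlled up to `m + 1` only. So the Abel
  -- transform is applied to the first `m - 1` summands and the last one is merged into the boundary
  -- term, which avoids `L m`. Three contributions remain, each at most `S * X`; hence the factor 3.
  obtain ⟨p, rfl⟩ : ∃ p, m = p + 1 := ⟨m - 1, by omega⟩
  have hsum : ∑ i ∈ Finset.range (p + 1), (1 / 2) * (half H (i + 1) (q (i + 1) - q i)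
        + half H i (q (i + 1) - q i))
      = L p (q (p + 1)) - L 0 (q 0) - ∑ i ∈ Finset.range p, (L (i + 1) - L i) (q (i + 1)) := by
    have : ∀ i, (1 / 2) * (half H (i + 1) (q (i + 1) - q i) + half H i (q (i + 1) - q i))
        = L i (q (i + 1) - q i) := fun i => by
      simp [hL]
      ring
    simp_rw [this]
    rw [Finset.sum_range_succ, key p]
    simp only [map_sub]
    ring
  have hLv : ∀ n ≤ p, ∀ l ≤ p + 1, |L n (q l)| ≤ S * X := by
    intro n hn l hl
    have h1 := abs_le.1 (hval' n (by omega) l hl)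
    have h2 := abs_le.1 (hval' (n + 1) (by omega) l hl)
    have h3 := abs_le.1 (hval' (n + 2) (by omega) l hl)
    have : L n (q l) = 1 / 4 * (H (n + 2) (q l) + 2 * H (n + 1) (q l) + H n (q l)) := by
      simp [hL, half]; ring
    rw [this, abs_le]
    constructor <;> linarith
  have hLd : ∀ i < p, |(L (i + 1) - L i) (q (i + 1))|
      ≤ 1 / 4 * (d (i + 2) * X + 2 * (d (i + 1) * X) + d i * X) := by
    intro i hi
    have h1 := abs_le.1 (hbd i (by omega) (i + 1) (by omega))
    have h2 := abs_le.1 (hbd (i + 1) (by omega) (i + 1) (by omega))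
    have h3 := abs_le.1 (hbd (i + 2) (by omega) (i + 1) (by omega))
    have : (L (i + 1) - L i) (q (i + 1)) = 1 / 4 * ((H (i + 2 + 1) (q (i + 1))
        - H (i + 2) (q (i + 1))) + 2 * (H (i + 1 + 1) (q (i + 1)) - H (i + 1) (q (i + 1)))
        + (H (i + 1) (q (i + 1)) - H i (q (i + 1)))) := by
      simp [hL, half]; ring
    rw [this, abs_le]
    constructor <;> linarith
  have hshift : ∀ c ≤ 2, ∑ i ∈ Finset.range p, d (i + c) ≤ S := by
    intro c hc
    rw [hS, Finset.range_eq_Ico, Finset.sum_Ico_add' d 0 p c]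
    refine Finset.sum_le_sum_of_subset_of_nonneg (fun x hx => ?_) fun _ _ _ => hd _
    simp only [Finset.mem_Ico, Finset.mem_range] at hx ⊢
    omega
  have hD : |∑ i ∈ Finset.range p, (L (i + 1) - L i) (q (i + 1))| ≤ S * X := by
    calc _ ≤ ∑ i ∈ Finset.range p, |(L (i + 1) - L i) (q (i + 1))| :=
          Finset.abs_sum_le_sum_abs _ _
      _ ≤ ∑ i ∈ Finset.range p, 1 / 4 * (d (i + 2) * X + 2 * (d (i + 1) * X) + d i * X) :=
          Finset.sum_le_sum fun i hi => hLd i (Finset.mem_range.1 hi)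
      _ = 1 / 4 * (∑ i ∈ Finset.range p, d (i + 2) + 2 * ∑ i ∈ Finset.range p, d (i + 1)
            + ∑ i ∈ Finset.range p, d (i + 0)) * X := by
          simp only [← Finset.mul_sum, Finset.sum_add_distrib, ← Finset.sum_mul, add_zero]
          ring
      _ ≤ S * X := by
          refine mul_le_mul_of_nonneg_right ?_ hX0
          linarith [hshift 0 (by omega), hshift 1 (by omega), hshift 2 le_rfl]
  rw [hsum]
  have h1 := abs_le.1 (hLv p le_rfl (p + 1) le_rfl)
  have h2 := abs_le.1 (hLv 0 (by omega) 0 (by omega))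
  have h3 := abs_le.1 hD
  rw [abs_le]
  constructor <;> linarith

/-- A quadratic discrete Gronwall inequality: if, for the running maximum `X` of `e`,
`e n ^ 2 ≤ e 0 * X + (b + γ k ∑_{j ≤ n} e j) X`, then `e` is bounded by the data. -/
theorem le_of_sq_le_running_max {e : ℕ → ℝ} (he : ∀ n, 0 ≤ e n) {b γ k T : ℝ} (hb : 0 ≤ b)
    (hγ : 0 ≤ γ) (hk : 0 ≤ k) (hγk : γ * k ≤ 1 / 2) (m : ℕ) (hmT : m * k ≤ T)
    (h : ∀ n ≤ m, ∀ X, (∀ j ≤ n, e j ≤ X) →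
      e n ^ 2 ≤ (e 0 + b + γ * k * ∑ j ∈ Finset.range (n + 1), e j) * X) :
    e m ≤ 2 * Real.exp (2 * γ * T) * (e 0 + b) := by
  set Y : ℕ → ℝ := fun n => partialSups e n with hY
  have heY : ∀ n, e n ≤ Y n := fun n => le_partialSups e n
  have hYmono : Monotone Y := (partialSups e).monotone
  have hY0 : ∀ n, 0 ≤ Y n := fun n => (he n).trans (heY n)
  have hγk0 : 0 ≤ γ * k := mul_nonneg hγ hk
  have step : ∀ n ≤ m, Y n ≤ 2 * (e 0 + b) + 2 * (γ * k) * ∑ j ∈ Finset.range n, Y j := by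
    intro n hn
    -- The hypothesis is used at the index where the running maximum is attained, so that both sides
    -- carry a factor `Y n`, which is divided out.
    obtain ⟨l, hl, hle⟩ := exists_partialSups_eq e n
    have hYl : Y n = e l := hle
    have h1 := h l (hl.trans hn) (Y n) fun j hj => (heY j).trans (hYmono (hj.trans hl))
    have h2 : ∑ j ∈ Finset.range (l + 1), e j ≤ ∑ j ∈ Finset.range (n + 1), Y j :=
      (Finset.sum_le_sum_of_subset_of_nonneg (Finset.range_mono (by omega))
        fun _ _ _ => he _).trans (Finset.sum_le_sum fun j _ => heY j)
    have h3 : Y n ≤ e 0 + b + γ * k * ∑ j ∈ Finset.range (n + 1), Y j := by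
      rcases (hY0 n).eq_or_lt with h0 | hpos
      · rw [← h0]
        have := he 0
        have : 0 ≤ ∑ j ∈ Finset.range (n + 1), Y j := Finset.sum_nonneg fun _ _ => hY0 _
        positivity
      · refine le_of_mul_le_mul_right ?_ hpos
        rw [← sq, hYl]
        rw [hYl] at h1
        refine h1.trans (mul_le_mul_of_nonneg_right ?_ (he l))
        gcongr
    -- The summand `j = n` is absorbed on the left by `γ * k ≤ 1 / 2`; this doubles all constants
    -- and makes the inequality explicit.
    rw [Finset.sum_range_succ] at h3
    have h4 : γ * k * Y n ≤ 1 / 2 * Y n := mul_le_mul_of_nonneg_right hγk (hY0 n)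
    linarith
  have hgr : ∀ n ≤ m, 2 * (e 0 + b) + 2 * (γ * k) * ∑ j ∈ Finset.range n, Y j
      ≤ 2 * (e 0 + b) * (1 + 2 * (γ * k)) ^ n := by
    intro n
    induction n with
    | zero => intro _; simp
    | succ n ih =>
      intro hn
      have h1 := ih (by omega)
      have h2 := step n (by omega)
      rw [Finset.sum_range_succ, pow_succ]
      have h3 := mul_le_mul_of_nonneg_left (h2.trans h1) (by positivity : 0 ≤ 2 * (γ * k))
      linarith
  have hexp : (1 + 2 * (γ * k)) ^ m ≤ Real.exp (2 * γ * T) := by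
    calc (1 + 2 * (γ * k)) ^ m ≤ Real.exp (2 * (γ * k)) ^ m := by
          gcongr
          linarith [Real.add_one_le_exp (2 * (γ * k))]
      _ = Real.exp (2 * γ * (m * k)) := by rw [← Real.exp_nat_mul]; ring_nf
      _ ≤ _ := by gcongr
  calc e m ≤ _ := ((heY m).trans (step m le_rfl)).trans (hgr m le_rfl)
    _ ≤ 2 * (e 0 + b) * Real.exp (2 * γ * T) := by
        have := he 0
        gcongr
    _ = _ := by ring

/-- Stability of the abstract mixed leapfrog scheme with memory: `H` collects the perturbation of
the flux equation and the memory term, `R` the source terms of the equation of motion. -/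
theorem energy_stability (l j : V →ₗ[ℝ] V →ₗ[ℝ] ℝ) (a a₂ j₁ : W →ₗ[ℝ] W →ₗ[ℝ] ℝ)
    (a₁ : V →ₗ[ℝ] W →ₗ[ℝ] ℝ)
    (hl : ∀ x y, l x y = l y x) (hj : ∀ x y, j x y = j y x) (ha : ∀ x y, a x y = a y x)
    (ha₂ : ∀ x y, a₂ x y = a₂ y x) (hj₁ : ∀ x y, j₁ x y = j₁ y x)
    (l_nonneg : ∀ x, 0 ≤ l x x) (j_nonneg : ∀ x, 0 ≤ j x x) (a₂_nonneg : ∀ x, 0 ≤ a₂ x x)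
    (j₁_nonneg : ∀ x, 0 ≤ j₁ x x) (nW : W → ℝ) {c : ℝ} (hc : 0 ≤ c) (nW_nonneg : ∀ w, 0 ≤ nW w)
    (hnW : ∀ w, nW w ≤ c * √(a₂ w w)) {k T β : ℝ} (hk : 0 < k) (hT : 0 ≤ T) (hβ : 0 ≤ β)
    (hkγ : 6 * c ^ 2 * β * (1 + T) * k ≤ 1 / 2) (m : ℕ) (hm : (m + 1) * k ≤ T)
    (u : ℕ → V) (q z : ℕ → W) (H : ℕ → W →ₗ[ℝ] ℝ) (R : ℕ → V →ₗ[ℝ] ℝ) (r g : ℕ → ℝ)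
    (hr : ∀ n, 0 ≤ r n) (hg : ∀ n, 0 ≤ g n) (H_zero : H 0 = 0)
    (h₁ : ∀ n ≤ m, ∀ w, a (half q n) w - a₁ (half u n) w + j₁ (half z n) w = 0)
    (h₂ : ∀ n ≤ m, ∀ τ, a₂ (half q n) τ - a (half z n) τ = half H n τ)
    (h₃ : ∀ n < m, ∀ v, l (dt2 k u (n + 1)) v + a₁ v (quarter z (n + 1))
      + j (quarter u (n + 1)) v = R (n + 1) v)
    (hR : ∀ n < m, ∀ v, |R (n + 1) v| ≤ r (n + 1) * √(l v v))
    (hH : ∀ n ≤ m, ∀ τ, |H (n + 1) τ - H n τ| ≤ (k * g n + β * k * (nW (half q n)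
      + k * ∑ i ∈ Finset.range n, nW (half q i))) * nW τ) :
    √(l (dt k u m) (dt k u m) + a₂ (half q m) (half q m) + j₁ (half z m) (half z m)
        + j (half u m) (half u m)) ≤ 2 * Real.exp (2 * (6 * c ^ 2 * β * (1 + T)) * T) *
      (√(l (dt k u 0) (dt k u 0) + a₂ (half q 0) (half q 0) + j₁ (half z 0) (half z 0)
        + j (half u 0) (half u 0)) + (2 * (k * ∑ n ∈ Finset.range m, r (n + 1))
        + 6 * c * (k * ∑ n ∈ Finset.range (m + 1), g n))) := by
  set e2 : ℕ → ℝ := fun n => l (dt k u n) (dt k u n) + a₂ (half q n) (half q n)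
    + j₁ (half z n) (half z n) + j (half u n) (half u n) with he2
  have e2_nonneg : ∀ n, 0 ≤ e2 n := fun n => by
    have h1 := l_nonneg (dt k u n)
    have h2 := a₂_nonneg (half q n)
    have h3 := j₁_nonneg (half z n)
    have h4 := j_nonneg (half u n)
    simp only [he2]
    positivity
  have hle : ∀ n, √(l (dt k u n) (dt k u n)) ≤ √(e2 n) := fun n => Real.sqrt_le_sqrt (by
    have h2 := a₂_nonneg (half q n)
    have h3 := j₁_nonneg (half z n)
    have h4 := j_nonneg (half u n)
    simp only [he2]
    linarith)
  have hqe : ∀ n, nW (half q n) ≤ c * √(e2 n) := fun n => (hnW _).trans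
    (mul_le_mul_of_nonneg_left (Real.sqrt_le_sqrt (by
      have h2 := l_nonneg (dt k u n)
      have h3 := j₁_nonneg (half z n)
      have h4 := j_nonneg (half u n)
      simp only [he2]
      linarith)) hc)
  have hsum_r : 0 ≤ ∑ n ∈ Finset.range m, r (n + 1) := Finset.sum_nonneg fun _ _ => hr _
  have hsum_g : 0 ≤ ∑ n ∈ Finset.range (m + 1), g n := Finset.sum_nonneg fun _ _ => hg _
  -- Here 6 is the 2 of the energy identity times the 3 of the summation by parts. One factor `c`
  -- converts the norm of the test argument into energy, the other the norms inside the memory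
  -- bound. The 1 in `1 + T` comes from the newest quadrature node, the `T` from the older ones.
  have hγ : 0 ≤ 6 * c ^ 2 * β * (1 + T) := by positivity
  refine le_of_sq_le_running_max (e := fun n => √(e2 n)) (fun n => Real.sqrt_nonneg _)
    (b := 2 * (k * ∑ n ∈ Finset.range m, r (n + 1))
        + 6 * c * (k * ∑ n ∈ Finset.range (m + 1), g n)) (by positivity) hγ hk.le hkγ m
    (by linarith) ?_
  intro n hn X hX
  have hX0 : 0 ≤ X := (Real.sqrt_nonneg _).trans (hX 0 (Nat.zero_le n))
  rw [Real.sq_sqrt (e2_nonneg n)]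
  -- the energy identity, summed
  have tele : ∀ p ≤ n, e2 p = e2 0 + 2 * (∑ i ∈ Finset.range p,
        R (i + 1) (half u (i + 1) - half u i)
      + ∑ i ∈ Finset.range p, (1 / 2) * (half H (i + 1) (half q (i + 1) - half q i)
        + half H i (half q (i + 1) - half q i))) := by
    intro p
    induction p with
    | zero => intro _; simp
    | succ p ih =>
      intro hp
      have hs := energy_step l j a a₂ j₁ a₁ hl hj ha ha₂ hj₁ hk.ne' u q z (half H p)
        (half H (p + 1)) (R (p + 1)) p (h₁ p (by omega)) (h₁ (p + 1) (by omega))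
        (h₂ p (by omega)) (h₂ (p + 1) (by omega)) (h₃ p (by omega))
      have h' := ih (by omega)
      rw [Finset.sum_range_succ, Finset.sum_range_succ]
      simp only [he2] at h' ⊢
      linarith
  -- the source terms
  have hsrc : ∑ i ∈ Finset.range n, R (i + 1) (half u (i + 1) - half u i)
      ≤ k * (∑ i ∈ Finset.range m, r (i + 1)) * X := by
    have h1 : ∀ i ∈ Finset.range n, R (i + 1) (half u (i + 1) - half u i)
        ≤ k * r (i + 1) * X := by
      intro i hi
      have hi' := Finset.mem_range.1 hi
      rw [half_succ_sub_half hk.ne', map_smul, map_add, smul_eq_mul]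
      have a1 := (le_abs_self _).trans ((hR i (by omega) (dt k u (i + 1))).trans
        (mul_le_mul_of_nonneg_left ((hle _).trans (hX (i + 1) (by omega))) (hr _)))
      have a2 := (le_abs_self _).trans ((hR i (by omega) (dt k u i)).trans
        (mul_le_mul_of_nonneg_left ((hle _).trans (hX i (by omega))) (hr _)))
      have := mul_le_mul_of_nonneg_left (add_le_add a1 a2) (by positivity : 0 ≤ k / 2)
      linarith
    refine (Finset.sum_le_sum h1).trans ?_
    rw [← Finset.sum_mul, ← Finset.mul_sum]
    refine mul_le_mul_of_nonneg_right (mul_le_mul_of_nonneg_left ?_ hk.le) hX0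
    exact Finset.sum_le_sum_of_subset_of_nonneg (Finset.range_mono hn) fun _ _ _ => hr _
  -- the memory term and the perturbation of the flux equation
  set d : ℕ → ℝ := fun n => k * g n + β * k * (nW (half q n)
      + k * ∑ i ∈ Finset.range n, nW (half q i)) with hd
  have hd0 : ∀ n, 0 ≤ d n := fun n => by
    have h1 := hg n
    have h2 := nW_nonneg (half q n)
    have h3 : 0 ≤ ∑ i ∈ Finset.range n, nW (half q i) := Finset.sum_nonneg fun _ _ => nW_nonneg _
    simp only [hd]
    positivity
  have hmem := (le_abs_self _).trans (abs_sum_half_apply_le H nW d (half q) n (c * X) hd0 H_zero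
    (fun i hi => hH i (hi.trans hn))
    (fun i hi => (hqe i).trans (mul_le_mul_of_nonneg_left (hX i hi) hc)) (by positivity))
  have hdsum : ∑ i ∈ Finset.range (n + 1), d i ≤ k * ∑ i ∈ Finset.range (m + 1), g i
      + β * k * ((1 + T) * (c * ∑ i ∈ Finset.range (n + 1), √(e2 i))) := by
    have hs0 : 0 ≤ ∑ i ∈ Finset.range (n + 1), nW (half q i) :=
      Finset.sum_nonneg fun _ _ => nW_nonneg _
    have hsq : ∑ i ∈ Finset.range (n + 1), nW (half q i)
        ≤ c * ∑ i ∈ Finset.range (n + 1), √(e2 i) := by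
      rw [Finset.mul_sum]
      exact Finset.sum_le_sum fun i _ => hqe i
    -- Each inner sum is enlarged to the full one; the number of outer summands times `k` is at most
    -- `T`.
    have h1 : k * ∑ l ∈ Finset.range (n + 1), ∑ i ∈ Finset.range l, nW (half q i)
        ≤ T * ∑ i ∈ Finset.range (n + 1), nW (half q i) := by
      calc k * ∑ l ∈ Finset.range (n + 1), ∑ i ∈ Finset.range l, nW (half q i)
          ≤ k * ∑ l ∈ Finset.range (n + 1), ∑ i ∈ Finset.range (n + 1), nW (half q i) := by
            refine mul_le_mul_of_nonneg_left (Finset.sum_le_sum fun l hl => ?_) hk.le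
            exact Finset.sum_le_sum_of_subset_of_nonneg
              (Finset.range_mono (Finset.mem_range.1 hl).le) fun _ _ _ => nW_nonneg _
        _ = ((n + 1) * k) * ∑ i ∈ Finset.range (n + 1), nW (half q i) := by
            rw [Finset.sum_const, Finset.card_range, nsmul_eq_mul]
            push_cast
            ring
        _ ≤ _ := by
            refine mul_le_mul_of_nonneg_right (le_trans ?_ hm) hs0
            gcongr
    simp only [hd, Finset.sum_add_distrib, ← Finset.mul_sum]
    refine add_le_add (mul_le_mul_of_nonneg_left (Finset.sum_le_sum_of_subset_of_nonneg
      (Finset.range_mono (by omega)) fun _ _ _ => hg _) hk.le)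
      (mul_le_mul_of_nonneg_left ?_ (by positivity))
    calc _ ≤ (1 + T) * ∑ i ∈ Finset.range (n + 1), nW (half q i) := by linarith
      _ ≤ _ := mul_le_mul_of_nonneg_left hsq (by positivity)
  have h0 : e2 0 ≤ √(e2 0) * X := by
    calc e2 0 = √(e2 0) * √(e2 0) := (Real.mul_self_sqrt (e2_nonneg 0)).symm
      _ ≤ _ := mul_le_mul_of_nonneg_left (hX 0 (Nat.zero_le n)) (Real.sqrt_nonneg _)
  have h5 := mul_le_mul_of_nonneg_right hdsum (by positivity : 0 ≤ 6 * c * X)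
  rw [tele n le_rfl]
  refine (add_le_add h0 (mul_le_mul_of_nonneg_left (add_le_add hsrc hmem) two_pos.le)).trans ?_
  linarith

end Energy

/-! ### The forms over the domain -/

theorem integral_abs_mul_abs_le {X : Type*} [MeasurableSpace X] {μ : Measure X} {f g : X → ℝ}
    (hf : MemLp f 2 μ) (hg : MemLp g 2 μ) :
    ∫ x, |f x| * |g x| ∂μ ≤ √(∫ x, f x ^ 2 ∂μ) * √(∫ x, g x ^ 2 ∂μ) := by
  have h2 : ENNReal.ofReal (2 : ℝ) = 2 := by norm_num
  have := integral_mul_norm_le_Lp_mul_Lq (μ := μ) (f := f) (g := g)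
    Real.HolderConjugate.two_two (by rwa [h2]) (by rwa [h2])
  simpa only [Real.norm_eq_abs, Real.rpow_two, sq_abs, Real.sqrt_eq_rpow] using this

theorem abs_integral_mul_le {X : Type*} [MeasurableSpace X] {μ : Measure X} {f g : X → ℝ}
    (hf : MemLp f 2 μ) (hg : MemLp g 2 μ) :
    |∫ x, f x * g x ∂μ| ≤ √(∫ x, f x ^ 2 ∂μ) * √(∫ x, g x ^ 2 ∂μ) := by
  refine (abs_integral_le_integral_abs).trans ?_
  simpa only [abs_mul] using integral_abs_mul_abs_le hf hg

theorem l2Norm_add_le {Ω : Set Plane} {f g : Plane → ℝ} (hf : MemLp f 2 (volume.restrict Ω))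
    (hg : MemLp g 2 (volume.restrict Ω)) : l2Norm Ω (f + g) ≤ l2Norm Ω f + l2Norm Ω g := by
  have h := (le_abs_self _).trans (abs_integral_mul_le hf hg)
  unfold l2Norm
  refine Real.sqrt_le_iff.2 ⟨by positivity, ?_⟩
  have hfg : Integrable (fun x => f x * g x) (volume.restrict Ω) := hf.integrable_mul hg
  have e : ∫ x in Ω, (f + g) x ^ 2
      = (∫ x in Ω, f x ^ 2) + 2 * (∫ x in Ω, f x * g x) + ∫ x in Ω, g x ^ 2 := by
    have hsq : Integrable (fun x => f x ^ 2 + 2 * (f x * g x)) (volume.restrict Ω) :=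
      hf.integrable_sq.add (hfg.const_mul 2)
    rw [← integral_const_mul, ← integral_add hf.integrable_sq (hfg.const_mul 2),
      ← integral_add hsq hg.integrable_sq]
    refine integral_congr_ae (.of_forall fun x => ?_)
    simp only [Pi.add_apply]
    ring
  rw [e, add_sq, Real.sq_sqrt (integral_nonneg fun x => sq_nonneg _),
    Real.sq_sqrt (integral_nonneg fun x => sq_nonneg _)]
  linarith

theorem l2Norm_smul {Ω : Set Plane} (c : ℝ) (f : Plane → ℝ) :
    l2Norm Ω (c • f) = |c| * l2Norm Ω f := by
  unfold l2Norm
  simp only [Pi.smul_apply, smul_eq_mul, mul_pow, integral_const_mul]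
  rw [Real.sqrt_mul (sq_nonneg c), Real.sqrt_sq_eq_abs]

/-- A matrix field on `Ω` with measurable entries that are bounded by `c`. -/
def BoundedField (Ω : Set Plane) (S : Plane → Matrix (Fin 2) (Fin 2) ℝ) (c : ℝ) : Prop :=
  ∀ i j, AEStronglyMeasurable (fun x => S x i j) (volume.restrict Ω) ∧ ∀ x ∈ Ω, |S x i j| ≤ c

theorem BoundedField.sub {Ω : Set Plane} {S S' : Plane → Matrix (Fin 2) (Fin 2) ℝ} {c c' d : ℝ}
    (hS : BoundedField Ω S c) (hS' : BoundedField Ω S' c')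
    (h : ∀ i j, ∀ x ∈ Ω, |S x i j - S' x i j| ≤ d) : BoundedField Ω (fun x => S x - S' x) d :=
  fun i j => ⟨(hS i j).1.sub (hS' i j).1, h i j⟩

namespace Discretization

variable {Ω : Set Plane} (D : Discretization Ω)

theorem val_add (v w : D.Broken) : D.val (v + w) = D.val v + D.val w := by
  funext x
  simp only [val, Pi.add_apply, map_add, ← Finset.sum_add_distrib]
  refine Finset.sum_congr rfl fun i _ => ?_
  by_cases h : x ∈ interior (D.cell i).carrier <;> simp [h]

theorem val_smul (c : ℝ) (v : D.Broken) : D.val (c • v) = c • D.val v := by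
  funext x
  simp only [val, Pi.smul_apply, smul_eq_mul, Finset.mul_sum]
  refine Finset.sum_congr rfl fun i _ => ?_
  by_cases h : x ∈ interior (D.cell i).carrier <;> simp [h, smul_eval]

theorem continuous_eval_plane (p : MvPolynomial (Fin 2) ℝ) :
    Continuous fun x : Plane => eval (fun c => x c) p :=
  p.continuous_eval.comp (PiLp.continuous_ofLp 2 _)

theorem isCompact_carrier (K : Cell) : IsCompact K.carrier :=
  (Set.finite_range _).isCompact_convexHull ℝ

theorem measurable_val (v : D.Broken) : Measurable (D.val v) := by
  unfold val
  exact Finset.measurable_sum _ fun i _ =>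
    (continuous_eval_plane (v i)).measurable.indicator isOpen_interior.measurableSet

theorem exists_abs_val_le (v : D.Broken) : ∃ c, ∀ x, |D.val v x| ≤ c := by
  have h : ∀ i, ∃ c, ∀ x, |(interior (D.cell i).carrier).indicator
      (fun y : Plane => eval (fun c => y c) (v i)) x| ≤ c := fun i => by
    obtain ⟨c, hc⟩ := (isCompact_carrier (D.cell i)).exists_bound_of_continuousOn
      (continuous_eval_plane (v i)).continuousOn
    refine ⟨max c 0, fun x => ?_⟩
    by_cases hx : x ∈ interior (D.cell i).carrier
    · rw [Set.indicator_of_mem hx]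
      exact (hc x (interior_subset hx)).trans (le_max_left _ _)
    · simp [hx]
  choose c hc using h
  exact ⟨∑ i, c i, fun x => (Finset.abs_sum_le_sum_abs _ _).trans
    (Finset.sum_le_sum fun i _ => hc i x)⟩

theorem memLp_val (hΩ : volume Ω ≠ ⊤) (v : D.Broken) :
    MemLp (D.val v) 2 (volume.restrict Ω) := by
  have : IsFiniteMeasure (volume.restrict Ω) := isFiniteMeasure_restrict.2 hΩ
  obtain ⟨c, hc⟩ := D.exists_abs_val_le v
  exact MemLp.of_bound (D.measurable_val v).aestronglyMeasurable c (.of_forall hc)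

theorem l2Inner_comm (v w : D.Broken) : D.l2Inner (D.val v) w = D.l2Inner (D.val w) v := by
  simp only [l2Inner, mul_comm]

theorem l2Inner_add_right (hΩ : volume Ω ≠ ⊤) {g : Plane → ℝ}
    (hg : MemLp g 2 (volume.restrict Ω)) (v w : D.Broken) :
    D.l2Inner g (v + w) = D.l2Inner g v + D.l2Inner g w := by
  unfold l2Inner
  have h : ∀ v, Integrable (fun x => g x * D.val v x) (volume.restrict Ω) := fun v =>
    hg.integrable_mul (D.memLp_val hΩ v)
  rw [← integral_add (h v) (h w)]
  simp only [val_add, Pi.add_apply, mul_add]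

theorem l2Inner_smul_right (c : ℝ) (g : Plane → ℝ) (v : D.Broken) :
    D.l2Inner g (c • v) = c * D.l2Inner g v := by
  unfold l2Inner
  rw [← integral_const_mul]
  simp only [val_smul, Pi.smul_apply, smul_eq_mul, mul_left_comm]

/-- The functional `v ↦ (g, v)` on broken polynomials. -/
noncomputable def l2Functional (hΩ : volume Ω ≠ ⊤) {g : Plane → ℝ}
    (hg : MemLp g 2 (volume.restrict Ω)) : D.Broken →ₗ[ℝ] ℝ where
  toFun := D.l2Inner g
  map_add' := D.l2Inner_add_right hΩ hg
  map_smul' c v := D.l2Inner_smul_right c g v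

/-- The `L²` inner product of broken polynomials as a bilinear map. -/
noncomputable def l2Form (hΩ : volume Ω ≠ ⊤) : D.Broken →ₗ[ℝ] D.Broken →ₗ[ℝ] ℝ :=
  LinearMap.mk₂ ℝ (fun v w => D.l2Inner (D.val v) w)
    (fun v v' w => by
      simp only [D.l2Inner_comm _ w, D.l2Inner_add_right hΩ (D.memLp_val hΩ w)])
    (fun c v w => by simp only [D.l2Inner_comm _ w, D.l2Inner_smul_right, smul_eq_mul])
    (fun v w w' => D.l2Inner_add_right hΩ (D.memLp_val hΩ v) w w')
    (fun c v w => D.l2Inner_smul_right c _ w)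

theorem l2Inner_self (v : D.Broken) : D.l2Inner (D.val v) v = ∫ x in Ω, D.val v x ^ 2 := by
  simp only [l2Inner, sq]

theorem abs_l2Inner_le (hΩ : volume Ω ≠ ⊤) {g : Plane → ℝ}
    (hg : MemLp g 2 (volume.restrict Ω)) (v : D.Broken) :
    |D.l2Inner g v| ≤ l2Norm Ω g * D.normV v := by
  rw [normV, l2Inner_self]
  exact abs_integral_mul_le hg (D.memLp_val hΩ v)

section Weighted

variable {S : Plane → Matrix (Fin 2) (Fin 2) ℝ} {c : ℝ}

theorem integrable_weighted (hΩ : volume Ω ≠ ⊤) (hm : MeasurableSet Ω) (hS : BoundedField Ω S c)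
    (v w : D.Broken) (i j : Fin 2) :
    Integrable (fun x => S x i j * (D.val v x * D.val w x)) (volume.restrict Ω) :=
  Integrable.bdd_mul (c := c) ((D.memLp_val hΩ v).integrable_mul (D.memLp_val hΩ w)) (hS i j).1
    ((ae_restrict_iff' hm).2 (.of_forall fun x hx => (hS i j).2 x hx))

/-- Linearity and bounds are proved entry by entry, where each scalar integrand is a bounded
coefficient times a product of two `L²` functions and so is integrable. -/
theorem weighted_eq_sum (hΩ : volume Ω ≠ ⊤) (hm : MeasurableSet Ω) (hS : BoundedField Ω S c)
    (p w : Fin 2 → D.Broken) : D.weighted S p w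
      = ∑ i, ∑ j, ∫ x in Ω, S x i j * (D.val (p j) x * D.val (w i) x) := by
  unfold weighted
  simp_rw [← integral_finsetSum _ fun j _ => D.integrable_weighted hΩ hm hS (p j) (w _) _ j]
  rw [← integral_finsetSum _ fun i _ => integrable_finsetSum _ fun j _ =>
    D.integrable_weighted hΩ hm hS (p j) (w i) i j]
  refine integral_congr_ae (.of_forall fun x => ?_)
  simp only [dotProduct, Matrix.mulVec, vecVal, Finset.sum_mul, mul_assoc]

/-- `∫_Ω S p · w` as a bilinear map. -/
noncomputable def weightedForm (hΩ : volume Ω ≠ ⊤) (hm : MeasurableSet Ω)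
    (hS : BoundedField Ω S c) :
    (Fin 2 → D.Broken) →ₗ[ℝ] (Fin 2 → D.Broken) →ₗ[ℝ] ℝ :=
  LinearMap.mk₂ ℝ (D.weighted S)
    (fun p p' w => by
      simp only [D.weighted_eq_sum hΩ hm hS, ← Finset.sum_add_distrib]
      refine Finset.sum_congr rfl fun i _ => Finset.sum_congr rfl fun j _ => ?_
      rw [← integral_add (D.integrable_weighted hΩ hm hS _ _ _ _)
        (D.integrable_weighted hΩ hm hS _ _ _ _)]
      simp only [Pi.add_apply, val_add, add_mul, mul_add])
    (fun r p w => by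
      simp only [D.weighted_eq_sum hΩ hm hS, smul_eq_mul, Finset.mul_sum, ← integral_const_mul]
      refine Finset.sum_congr rfl fun i _ => Finset.sum_congr rfl fun j _ => ?_
      congr 1
      funext x
      simp only [Pi.smul_apply, val_smul, smul_eq_mul]
      ring)
    (fun p w w' => by
      simp only [D.weighted_eq_sum hΩ hm hS, ← Finset.sum_add_distrib]
      refine Finset.sum_congr rfl fun i _ => Finset.sum_congr rfl fun j _ => ?_
      rw [← integral_add (D.integrable_weighted hΩ hm hS _ _ _ _)
        (D.integrable_weighted hΩ hm hS _ _ _ _)]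
      simp only [Pi.add_apply, val_add, mul_add])
    (fun r p w => by
      simp only [D.weighted_eq_sum hΩ hm hS, smul_eq_mul, Finset.mul_sum, ← integral_const_mul]
      refine Finset.sum_congr rfl fun i _ => Finset.sum_congr rfl fun j _ => ?_
      congr 1
      funext x
      simp only [Pi.smul_apply, val_smul, smul_eq_mul]
      ring)

theorem weighted_comm (hm : MeasurableSet Ω) (hS : ∀ x ∈ Ω, (S x).IsSymm)
    (p w : Fin 2 → D.Broken) : D.weighted S p w = D.weighted S w p := by
  unfold weighted
  refine setIntegral_congr_fun hm fun x hx => ?_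
  rw [dotProduct_comm, Matrix.dotProduct_mulVec, ← Matrix.mulVec_transpose, (hS x hx).eq]

theorem formA_eq_weighted (p w : Fin 2 → D.Broken) :
    D.formA p w = D.weighted (fun _ => 1) p w := by
  simp [formA, weighted]

theorem boundedField_one : BoundedField Ω (fun _ => 1) 1 := fun i j =>
  ⟨aestronglyMeasurable_const, fun _ _ => by
    fin_cases i <;> fin_cases j <;> simp⟩

theorem formA_self (hΩ : volume Ω ≠ ⊤) (p : Fin 2 → D.Broken) :
    D.formA p p = ∑ i, ∫ x in Ω, D.val (p i) x ^ 2 := by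
  rw [← integral_finsetSum _ fun i _ => (D.memLp_val hΩ (p i)).integrable_sq]
  simp only [formA, dotProduct, vecVal, sq]

theorem sqrt_integral_val_le_normW (hΩ : volume Ω ≠ ⊤) (p : Fin 2 → D.Broken) (i : Fin 2) :
    √(∫ x in Ω, D.val (p i) x ^ 2) ≤ D.normW p := by
  rw [normW, formA_self D hΩ]
  exact Real.sqrt_le_sqrt (Finset.single_le_sum
    (f := fun i => ∫ x in Ω, D.val (p i) x ^ 2)
    (fun j _ => integral_nonneg fun x => sq_nonneg _) (Finset.mem_univ i))

theorem abs_weighted_le (hΩ : volume Ω ≠ ⊤) (hm : MeasurableSet Ω) (hS : BoundedField Ω S c)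
    (hc : 0 ≤ c) (p w : Fin 2 → D.Broken) :
    |D.weighted S p w| ≤ 4 * c * (D.normW p * D.normW w) := by
  -- Cauchy–Schwarz for each of the four matrix entries; their number is the constant 4.
  have h : ∀ i j, |∫ x in Ω, S x i j * (D.val (p j) x * D.val (w i) x)|
      ≤ c * (D.normW p * D.normW w) := fun i j => by
    have hp := D.memLp_val hΩ (p j)
    have hw := D.memLp_val hΩ (w i)
    have hint : Integrable (fun x => |D.val (p j) x| * |D.val (w i) x|) (volume.restrict Ω) :=
      hp.abs.integrable_mul hw.abs
    calc _ ≤ ∫ x in Ω, |S x i j * (D.val (p j) x * D.val (w i) x)| :=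
          abs_integral_le_integral_abs
      _ ≤ ∫ x in Ω, c * (|D.val (p j) x| * |D.val (w i) x|) := by
          refine setIntegral_mono_on (D.integrable_weighted hΩ hm hS _ _ _ _).abs
            (hint.const_mul c) hm fun x hx => ?_
          rw [abs_mul, abs_mul]
          exact mul_le_mul_of_nonneg_right ((hS i j).2 x hx) (by positivity)
      _ = c * ∫ x in Ω, |D.val (p j) x| * |D.val (w i) x| := integral_const_mul _ _
      _ ≤ _ := by
          refine mul_le_mul_of_nonneg_left ((integral_abs_mul_abs_le hp hw).trans ?_) hc
          exact mul_le_mul (D.sqrt_integral_val_le_normW hΩ p j)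
            (D.sqrt_integral_val_le_normW hΩ w i) (Real.sqrt_nonneg _) (Real.sqrt_nonneg _)
  rw [D.weighted_eq_sum hΩ hm hS]
  simp only [Fin.sum_univ_two]
  have h00 := abs_le.1 (h 0 0)
  have h01 := abs_le.1 (h 0 1)
  have h10 := abs_le.1 (h 1 0)
  have h11 := abs_le.1 (h 1 1)
  rw [abs_le]
  constructor <;> linarith

theorem mul_formA_self_le_weighted (hΩ : volume Ω ≠ ⊤) (hm : MeasurableSet Ω)
    (hS : BoundedField Ω S c) {α : ℝ}
    (hα : ∀ x ∈ Ω, ∀ ξ : Fin 2 → ℝ, α * (ξ ⬝ᵥ ξ) ≤ (S x *ᵥ ξ) ⬝ᵥ ξ) (p : Fin 2 → D.Broken) :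
    α * D.formA p p ≤ D.weighted S p p := by
  have hint : ∀ {S' : Plane → Matrix (Fin 2) (Fin 2) ℝ} {c' : ℝ}, BoundedField Ω S' c' →
      Integrable (fun x => (S' x *ᵥ D.vecVal p x) ⬝ᵥ D.vecVal p x) (volume.restrict Ω) := by
    intro S' c' hS'
    have := integrable_finsetSum Finset.univ fun i _ => integrable_finsetSum Finset.univ
      fun j _ => D.integrable_weighted hΩ hm hS' (p j) (p i) i j
    refine this.congr (.of_forall fun x => ?_)
    simp only [dotProduct, Matrix.mulVec, vecVal, Finset.sum_mul, mul_assoc]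
  have h1 := hint (boundedField_one (Ω := Ω))
  simp only [Matrix.one_mulVec] at h1
  unfold formA weighted
  rw [← integral_const_mul]
  exact setIntegral_mono_on (h1.const_mul α) (hint hS) hm fun x hx => hα x hx _

end Weighted

end Discretization

/-! ### The forms over the edges -/

namespace Discretization

variable {Ω : Set Plane} (D : Discretization Ω)

theorem hausdorffMeasure_seg_ne_top (e : D.Side) :
    Measure.hausdorffMeasure 1 (D.seg e) ≠ ⊤ := by
  unfold seg Cell.side
  rw [hausdorffMeasure_segment]
  exact edist_ne_top _ _

theorem isCompact_seg (e : D.Side) : IsCompact (D.seg e) := by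
  unfold seg Cell.side
  rw [segment_eq_image_lineMap]
  exact isCompact_Icc.image AffineMap.lineMap_continuous

/-- A continuous majorant is bounded on the segment, which is compact and of finite length. The
majorant is needed because `C12` is only measurable and bounded; all other edge integrands are
continuous. -/
theorem integrableOn_seg_of_norm_le {s : Set Plane} {e : D.Side} (hs : s ⊆ D.seg e)
    {φ g : Plane → ℝ} (hφ : Measurable φ) (hg : Continuous g) (h : ∀ x, |φ x| ≤ g x) :
    IntegrableOn φ s (Measure.hausdorffMeasure 1) := by
  obtain ⟨c, hc⟩ := (D.isCompact_seg e).exists_bound_of_continuousOn hg.continuousOn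
  refine IntegrableOn.mono_set ?_ hs
  refine Measure.integrableOn_of_bounded (M := c) (D.hausdorffMeasure_seg_ne_top e)
    hφ.aestronglyMeasurable ?_
  refine (ae_restrict_iff' (D.isCompact_seg e).measurableSet).2 (.of_forall fun x hx => ?_)
  exact (h x).trans ((le_abs_self _).trans (hc x hx))

theorem integrableOn_seg {s : Set Plane} {e : D.Side} (hs : s ⊆ D.seg e)
    {φ : Plane → ℝ} (hφ : Continuous φ) : IntegrableOn φ s (Measure.hausdorffMeasure 1) :=
  D.integrableOn_seg_of_norm_le hs hφ.measurable hφ.abs fun _ => le_rfl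

theorem intInterior_add {φ ψ : D.Side → D.Side → Plane → ℝ}
    (hφ : ∀ e e', IntegrableOn (φ e e') (D.seg e ∩ D.seg e') (Measure.hausdorffMeasure 1))
    (hψ : ∀ e e', IntegrableOn (ψ e e') (D.seg e ∩ D.seg e') (Measure.hausdorffMeasure 1)) :
    D.intInterior (fun e e' x => φ e e' x + ψ e e' x) = D.intInterior φ + D.intInterior ψ := by
  simp only [intInterior, ← Finset.sum_add_distrib]
  refine Finset.sum_congr rfl fun e _ => Finset.sum_congr rfl fun e' _ => ?_
  split_ifs
  · exact integral_add (hφ e e') (hψ e e')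
  · simp

theorem intInterior_smul (c : ℝ) (φ : D.Side → D.Side → Plane → ℝ) :
    D.intInterior (fun e e' x => c * φ e e' x) = c * D.intInterior φ := by
  simp only [intInterior, Finset.mul_sum]
  refine Finset.sum_congr rfl fun e _ => Finset.sum_congr rfl fun e' _ => ?_
  split_ifs
  · exact integral_const_mul _ _
  · simp

theorem intInterior_nonneg {φ : D.Side → D.Side → Plane → ℝ} (h : ∀ e e' x, 0 ≤ φ e e' x) :
    0 ≤ D.intInterior φ := by
  refine Finset.sum_nonneg fun e _ => Finset.sum_nonneg fun e' _ => ?_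
  split_ifs
  · exact integral_nonneg fun x => h e e' x
  · exact le_rfl

theorem intBoundary_add {φ ψ : D.Side → Plane → ℝ}
    (hφ : ∀ e, IntegrableOn (φ e) (D.seg e ∩ frontier Ω) (Measure.hausdorffMeasure 1))
    (hψ : ∀ e, IntegrableOn (ψ e) (D.seg e ∩ frontier Ω) (Measure.hausdorffMeasure 1)) :
    D.intBoundary (fun e x => φ e x + ψ e x) = D.intBoundary φ + D.intBoundary ψ := by
  simp only [intBoundary, ← Finset.sum_add_distrib]
  exact Finset.sum_congr rfl fun e _ => integral_add (hφ e) (hψ e)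

theorem intBoundary_smul (c : ℝ) (φ : D.Side → Plane → ℝ) :
    D.intBoundary (fun e x => c * φ e x) = c * D.intBoundary φ := by
  simp only [intBoundary, Finset.mul_sum]
  exact Finset.sum_congr rfl fun e _ => integral_const_mul _ _

theorem intBoundary_nonneg {φ : D.Side → Plane → ℝ} (h : ∀ e x, 0 ≤ φ e x) :
    0 ≤ D.intBoundary φ :=
  Finset.sum_nonneg fun e _ => integral_nonneg fun x => h e x

/-! #### Traces -/

theorem tr_add (v w : D.Broken) (i : Fin D.numCells) (x : Plane) :
    D.tr (v + w) i x = D.tr v i x + D.tr w i x := by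
  simp [tr]

theorem tr_smul (c : ℝ) (v : D.Broken) (i : Fin D.numCells) (x : Plane) :
    D.tr (c • v) i x = c * D.tr v i x := by
  simp [tr, smul_eval]

theorem continuous_tr (v : D.Broken) (i : Fin D.numCells) : Continuous (D.tr v i) :=
  continuous_eval_plane (v i)

theorem vecTr_add (v w : Fin 2 → D.Broken) (i : Fin D.numCells) (x : Plane) :
    D.vecTr (v + w) i x = D.vecTr v i x + D.vecTr w i x := by
  ext c
  fin_cases c <;> simp [vecTr, tr_add]

theorem vecTr_smul (c : ℝ) (v : Fin 2 → D.Broken) (i : Fin D.numCells) (x : Plane) :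
    D.vecTr (c • v) i x = c • D.vecTr v i x := by
  ext c
  fin_cases c <;> simp [vecTr, tr_smul]

theorem continuous_vecTr (w : Fin 2 → D.Broken) (i : Fin D.numCells) :
    Continuous (D.vecTr w i) := by
  refine (PiLp.continuous_toLp 2 _).comp (continuous_pi fun c => ?_)
  fin_cases c
  · exact D.continuous_tr (w 0) i
  · exact D.continuous_tr (w 1) i

theorem jump_add (v w : D.Broken) (e e' : D.Side) (x : Plane) :
    D.jump (v + w) e e' x = D.jump v e e' x + D.jump w e e' x := by
  simp only [jump, tr_add]
  module

theorem jump_smul (c : ℝ) (v : D.Broken) (e e' : D.Side) (x : Plane) :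
    D.jump (c • v) e e' x = c • D.jump v e e' x := by
  simp only [jump, tr_smul]
  module

theorem continuous_jump (v : D.Broken) (e e' : D.Side) : Continuous (D.jump v e e') :=
  ((D.continuous_tr v _).smul continuous_const).add ((D.continuous_tr v _).smul continuous_const)

theorem bdryJump_add (v w : D.Broken) (e : D.Side) (x : Plane) :
    D.bdryJump (v + w) e x = D.bdryJump v e x + D.bdryJump w e x := by
  simp only [bdryJump, tr_add]
  module

theorem bdryJump_smul (c : ℝ) (v : D.Broken) (e : D.Side) (x : Plane) :
    D.bdryJump (c • v) e x = c • D.bdryJump v e x := by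
  simp only [bdryJump, tr_smul]
  module

theorem continuous_bdryJump (v : D.Broken) (e : D.Side) : Continuous (D.bdryJump v e) :=
  (D.continuous_tr v _).smul continuous_const

theorem vecJump_add (v w : Fin 2 → D.Broken) (e e' : D.Side) (x : Plane) :
    D.vecJump (v + w) e e' x = D.vecJump v e e' x + D.vecJump w e e' x := by
  simp only [vecJump, vecTr_add, inner_add_left]
  ring

theorem vecJump_smul (c : ℝ) (w : Fin 2 → D.Broken) (e e' : D.Side) (x : Plane) :
    D.vecJump (c • w) e e' x = c * D.vecJump w e e' x := by
  simp only [vecJump, vecTr_smul, real_inner_smul_left]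
  ring

theorem continuous_vecJump (w : Fin 2 → D.Broken) (e e' : D.Side) :
    Continuous (D.vecJump w e e') :=
  ((D.continuous_vecTr w _).inner continuous_const).add
    ((D.continuous_vecTr w _).inner continuous_const)

theorem vecAvg_add (v w : Fin 2 → D.Broken) (e e' : D.Side) (x : Plane) :
    D.vecAvg (v + w) e e' x = D.vecAvg v e e' x + D.vecAvg w e e' x := by
  simp only [vecAvg, vecTr_add]
  module

theorem vecAvg_smul (c : ℝ) (w : Fin 2 → D.Broken) (e e' : D.Side) (x : Plane) :
    D.vecAvg (c • w) e e' x = c • D.vecAvg w e e' x := by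
  simp only [vecAvg, vecTr_smul]
  module

theorem continuous_vecAvg (w : Fin 2 → D.Broken) (e e' : D.Side) :
    Continuous (D.vecAvg w e e') := by
  unfold vecAvg
  have := D.continuous_vecTr w
  fun_prop

/-! #### The stabilization forms -/

theorem C11_nonneg (i j : Fin D.numCells) : 0 ≤ D.C11 i j := by
  have h : ∀ i, 0 ≤ D.h i := fun _ => Metric.diam_nonneg
  have := D.zeta_pos.le
  have := h i
  have := h j
  unfold C11
  positivity

theorem bdryC11_nonneg (i : Fin D.numCells) : 0 ≤ D.bdryC11 i := by
  have h : ∀ i, 0 ≤ D.h i := fun _ => Metric.diam_nonneg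
  have := D.zeta_pos.le
  have := h i
  unfold bdryC11
  positivity

theorem C22_nonneg (i j : Fin D.numCells) : 0 ≤ D.C22 i j := by
  have h : ∀ i, 0 ≤ D.h i := fun _ => Metric.diam_nonneg
  have := D.kappa_nonneg
  have := h i
  have := h j
  unfold C22
  positivity

theorem formJ1_comm (p w : Fin 2 → D.Broken) : D.formJ1 p w = D.formJ1 w p := by
  simp only [formJ1, mul_comm (D.vecJump p _ _ _)]

theorem formJ1_self_nonneg (p : Fin 2 → D.Broken) : 0 ≤ D.formJ1 p p :=
  D.intInterior_nonneg fun e e' _ => mul_nonneg (D.C22_nonneg e.1 e'.1) (mul_self_nonneg _)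

theorem formJ1_add_left (p p' w : Fin 2 → D.Broken) :
    D.formJ1 (p + p') w = D.formJ1 p w + D.formJ1 p' w := by
  have hc : ∀ (p : Fin 2 → D.Broken) (e e' : D.Side), IntegrableOn
      (fun x => D.C22 e.1 e'.1 * (D.vecJump p e e' x * D.vecJump w e e' x))
      (D.seg e ∩ D.seg e') (Measure.hausdorffMeasure 1) := fun p e e' =>
    D.integrableOn_seg Set.inter_subset_left
      (((D.continuous_vecJump p e e').mul (D.continuous_vecJump w e e')).const_mul _)
  unfold formJ1
  rw [← D.intInterior_add (hc p) (hc p')]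
  simp only [vecJump_add, add_mul, mul_add]

theorem formJ1_smul_left (c : ℝ) (p w : Fin 2 → D.Broken) :
    D.formJ1 (c • p) w = c * D.formJ1 p w := by
  unfold formJ1
  rw [← D.intInterior_smul]
  simp only [vecJump_smul]
  congr 1
  funext e e' x
  ring

/-- `J₁` as a bilinear map. -/
noncomputable def bilinJ1 : (Fin 2 → D.Broken) →ₗ[ℝ] (Fin 2 → D.Broken) →ₗ[ℝ] ℝ :=
  LinearMap.mk₂ ℝ D.formJ1 D.formJ1_add_left D.formJ1_smul_left
    (fun p w w' => by simp only [D.formJ1_comm p, D.formJ1_add_left])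
    (fun c p w => by simp only [D.formJ1_comm p, D.formJ1_smul_left, smul_eq_mul])

theorem formJ_comm (φ v : D.Broken) : D.formJ φ v = D.formJ v φ := by
  simp only [formJ, real_inner_comm]

theorem formJ_self_nonneg (φ : D.Broken) : 0 ≤ D.formJ φ φ :=
  add_nonneg
    (D.intInterior_nonneg fun e e' _ => mul_nonneg (D.C11_nonneg e.1 e'.1) real_inner_self_nonneg)
    (D.intBoundary_nonneg fun e _ => mul_nonneg (D.bdryC11_nonneg e.1) real_inner_self_nonneg)

theorem formJ_add_left (φ φ' v : D.Broken) :
    D.formJ (φ + φ') v = D.formJ φ v + D.formJ φ' v := by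
  have hi : ∀ (φ : D.Broken) (e e' : D.Side), IntegrableOn
      (fun x => D.C11 e.1 e'.1 * ⟪D.jump φ e e' x, D.jump v e e' x⟫)
      (D.seg e ∩ D.seg e') (Measure.hausdorffMeasure 1) := fun φ e e' =>
    D.integrableOn_seg Set.inter_subset_left
      (((D.continuous_jump φ e e').inner (D.continuous_jump v e e')).const_mul _)
  have hb : ∀ (φ : D.Broken) (e : D.Side), IntegrableOn
      (fun x => D.bdryC11 e.1 * ⟪D.bdryJump φ e x, D.bdryJump v e x⟫)
      (D.seg e ∩ frontier Ω) (Measure.hausdorffMeasure 1) := fun φ e =>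
    D.integrableOn_seg Set.inter_subset_left
      (((D.continuous_bdryJump φ e).inner (D.continuous_bdryJump v e)).const_mul _)
  unfold formJ
  rw [add_add_add_comm, ← D.intInterior_add (hi φ) (hi φ'), ← D.intBoundary_add (hb φ) (hb φ')]
  simp only [jump_add, bdryJump_add, inner_add_left, mul_add]

theorem formJ_smul_left (c : ℝ) (φ v : D.Broken) : D.formJ (c • φ) v = c * D.formJ φ v := by
  unfold formJ
  rw [mul_add, ← D.intInterior_smul, ← D.intBoundary_smul]
  simp only [jump_smul, bdryJump_smul, real_inner_smul_left, mul_left_comm]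

/-- `J` as a bilinear map. -/
noncomputable def bilinJ : D.Broken →ₗ[ℝ] D.Broken →ₗ[ℝ] ℝ :=
  LinearMap.mk₂ ℝ D.formJ D.formJ_add_left D.formJ_smul_left
    (fun p w w' => by simp only [D.formJ_comm p, D.formJ_add_left])
    (fun c p w => by simp only [D.formJ_comm p, D.formJ_smul_left, smul_eq_mul])

/-! #### The discrete gradient form -/

theorem integrableOn_flux (v : D.Broken) (p : Fin 2 → D.Broken) (e e' : D.Side) :
    IntegrableOn (fun x => ⟪D.vecAvg p e e' x - D.vecJump p e e' x • D.C12 x, D.jump v e e' x⟫)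
      (D.seg e ∩ D.seg e') (Measure.hausdorffMeasure 1) := by
  obtain ⟨c, hc⟩ := D.bounded_C12
  refine D.integrableOn_seg_of_norm_le Set.inter_subset_left
    (g := fun x => (‖D.vecAvg p e e' x‖ + |D.vecJump p e e' x| * c) * ‖D.jump v e e' x‖) ?_ ?_ ?_
  · exact (((D.continuous_vecAvg p e e').measurable).sub
      ((D.continuous_vecJump p e e').measurable.smul D.measurable_C12)).inner
      (D.continuous_jump v e e').measurable
  · exact ((D.continuous_vecAvg p e e').norm.add
      ((D.continuous_vecJump p e e').abs.mul continuous_const)).mul (D.continuous_jump v e e').norm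
  · intro x
    refine (abs_real_inner_le_norm _ _).trans (mul_le_mul_of_nonneg_right ?_ (norm_nonneg _))
    refine (norm_sub_le _ _).trans (add_le_add le_rfl ?_)
    rw [norm_smul, Real.norm_eq_abs]
    exact mul_le_mul_of_nonneg_left (hc x) (abs_nonneg _)

theorem integrableOn_bdryFlux (v : D.Broken) (p : Fin 2 → D.Broken) (e : D.Side) :
    IntegrableOn (fun x => ⟪D.vecTr p e.1 x, D.bdryJump v e x⟫)
      (D.seg e ∩ frontier Ω) (Measure.hausdorffMeasure 1) :=
  D.integrableOn_seg Set.inter_subset_left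
    ((D.continuous_vecTr p e.1).inner (D.continuous_bdryJump v e))

theorem integrableOn_grad (v : D.Broken) (p : Fin 2 → D.Broken) (i : Fin D.numCells) :
    IntegrableOn (fun x : Plane => ∑ c, eval (fun c => x c) (p c i * pderiv c (v i)))
      (D.cell i).carrier :=
  (continuous_finsetSum _ fun _ _ => continuous_eval_plane _).continuousOn.integrableOn_compact
    (isCompact_carrier _)

/-- `𝒜₁` as a bilinear map. -/
noncomputable def bilinA1 : D.Broken →ₗ[ℝ] (Fin 2 → D.Broken) →ₗ[ℝ] ℝ :=
  LinearMap.mk₂ ℝ D.formA1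
    (fun v v' p => by
      have h : ∀ a b c a' b' c' : ℝ,
          a - b - c + (a' - b' - c') = (a + a') - (b + b') - (c + c') := by intros; ring
      unfold formA1
      rw [h, ← Finset.sum_add_distrib,
        ← D.intInterior_add (D.integrableOn_flux v p) (D.integrableOn_flux v' p),
        ← D.intBoundary_add (D.integrableOn_bdryFlux v p) (D.integrableOn_bdryFlux v' p)]
      simp only [← integral_add (D.integrableOn_grad v p _) (D.integrableOn_grad v' p _),
        jump_add, bdryJump_add, inner_add_right, Pi.add_apply, map_add, mul_add,
        Finset.sum_add_distrib])
    (fun r v p => by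
      unfold formA1
      rw [smul_eq_mul, mul_sub, mul_sub, ← D.intInterior_smul, ← D.intBoundary_smul,
        Finset.mul_sum]
      simp only [← integral_const_mul, jump_smul, bdryJump_smul, inner_smul_right, Pi.smul_apply,
        Derivation.map_smul, mul_smul_comm, smul_eval, Finset.mul_sum])
    (fun v p p' => by
      have h : ∀ a b c a' b' c' : ℝ,
          a - b - c + (a' - b' - c') = (a + a') - (b + b') - (c + c') := by intros; ring
      unfold formA1
      rw [h, ← Finset.sum_add_distrib,
        ← D.intInterior_add (D.integrableOn_flux v p) (D.integrableOn_flux v p'),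
        ← D.intBoundary_add (D.integrableOn_bdryFlux v p) (D.integrableOn_bdryFlux v p')]
      simp only [← integral_add (D.integrableOn_grad v p _) (D.integrableOn_grad v p' _),
        ← inner_add_left, vecAvg_add, vecJump_add, vecTr_add, add_smul, add_sub_add_comm,
        Pi.add_apply, map_add, add_mul, Finset.sum_add_distrib])
    (fun r v p => by
      unfold formA1
      rw [smul_eq_mul, mul_sub, mul_sub, ← D.intInterior_smul, ← D.intBoundary_smul,
        Finset.mul_sum]
      simp only [← integral_const_mul, vecAvg_smul, vecJump_smul, vecTr_smul, mul_smul,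
        ← smul_sub, real_inner_smul_left, Pi.smul_apply,
        smul_mul_assoc, smul_eval, Finset.mul_sum])

end Discretization

/-! ### Boundedness of the functionals on the finite element spaces -/

/-- A linear functional on a finite-dimensional space is bounded with respect to the norm that a
definite symmetric form induces. -/
theorem exists_abs_le_mul_sqrt {X : Type*} [AddCommGroup X] [Module ℝ X] [FiniteDimensional ℝ X]
    (b : X →ₗ[ℝ] X →ₗ[ℝ] ℝ) (hsymm : ∀ x y, b x y = b y x) (hnonneg : ∀ x, 0 ≤ b x x)
    (hdef : ∀ x, b x x = 0 → x = 0) (F : X →ₗ[ℝ] ℝ) : ∃ c, ∀ x, |F x| ≤ c * √(b x x) := by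
  let core : InnerProductSpace.Core ℝ X :=
    { inner := fun x y => b x y
      conj_inner_symm := fun x y => hsymm y x
      re_inner_nonneg := hnonneg
      add_left := fun x y z => by simp
      smul_left := fun x y r => by simp
      definite := hdef }
  let : NormedAddCommGroup X := core.toNormedAddCommGroup
  let : InnerProductSpace ℝ X := .ofCore core.toCore
  refine ⟨‖LinearMap.toContinuousLinearMap F‖, fun x => ?_⟩
  -- The norm built from `core` is by definition the square root of `b x x`, and every functional is
  -- continuous in finite dimension.
  exact (LinearMap.toContinuousLinearMap F).le_opNorm x

/-- The content is that the quotients are bounded above: a real supremum of an unbounded family has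
the default value 0 and would bound nothing. -/
theorem abs_le_iSup_div_mul {X : Type*} [AddCommGroup X] [Module ℝ X] [FiniteDimensional ℝ X]
    (b : X →ₗ[ℝ] X →ₗ[ℝ] ℝ) (hsymm : ∀ x y, b x y = b y x) (hnonneg : ∀ x, 0 ≤ b x x)
    (hdef : ∀ x, b x x = 0 → x = 0) (F : X →ₗ[ℝ] ℝ) (x : X) :
    |F x| ≤ (⨆ χ : {χ : X // χ ≠ 0}, |F χ| / √(b χ χ)) * √(b x x) := by
  rcases eq_or_ne x 0 with rfl | hx
  · simp
  have hpos : ∀ y : X, y ≠ 0 → 0 < √(b y y) := fun y hy =>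
    Real.sqrt_pos.2 ((hnonneg y).lt_of_ne fun h => hy (hdef y h.symm))
  obtain ⟨c, hc⟩ := exists_abs_le_mul_sqrt b hsymm hnonneg hdef F
  rw [← div_le_iff₀ (hpos x hx)]
  refine le_ciSup (f := fun χ : {χ : X // χ ≠ 0} => |F χ| / √(b χ χ)) ⟨c, ?_⟩ ⟨x, hx⟩
  rintro _ ⟨y, rfl⟩
  exact (div_le_iff₀ (hpos y y.2)).2 (hc y)

/-! ### Definiteness of the `L²` form: cells have interior, and polynomials are determined there -/

namespace Cell

theorem mem_affineSpan_triple {u v : Plane} (h : cross u v ≠ 0) (a x : Plane) :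
    x ∈ affineSpan ℝ {a, a + u, a + v} := by
  have ha : a ∈ affineSpan ℝ {a, a + u, a + v} := subset_affineSpan ℝ _ (by simp)
  have hu : u ∈ (affineSpan ℝ {a, a + u, a + v}).direction := by
    have := AffineSubspace.vsub_mem_direction
      (subset_affineSpan ℝ _ (show a + u ∈ ({a, a + u, a + v} : Set Plane) by simp)) ha
    simpa using this
  have hv : v ∈ (affineSpan ℝ {a, a + u, a + v}).direction := by
    have := AffineSubspace.vsub_mem_direction
      (subset_affineSpan ℝ _ (show a + v ∈ ({a, a + u, a + v} : Set Plane) by simp)) ha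
    simpa using this
  -- Cramer's rule for the coordinates of `x - a` in the basis `u`, `v`.
  have e : x = ((cross (x - a) v / cross u v) • u + (cross u (x - a) / cross u v) • v) +ᵥ a := by
    have hi : x 0 = (cross (x - a) v / cross u v) * u 0 + (cross u (x - a) / cross u v) * v 0 + a 0
        ∧ x 1 = (cross (x - a) v / cross u v) * u 1 + (cross u (x - a) / cross u v) * v 1
          + a 1 := by
      constructor <;>
      · rw [div_mul_eq_mul_div, div_mul_eq_mul_div, ← add_div, ← sub_eq_iff_eq_add, eq_div_iff h]
        simp only [cross, PiLp.sub_apply]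
        ring
    ext i
    fin_cases i
    · simpa using hi.1
    · simpa using hi.2
  rw [e]
  exact AffineSubspace.vadd_mem_of_mem_direction
    (Submodule.add_mem _ (Submodule.smul_mem _ _ hu) (Submodule.smul_mem _ _ hv)) ha

theorem interior_carrier_nonempty (K : Cell) : (interior K.carrier).Nonempty := by
  unfold carrier
  rw [interior_convexHull_nonempty_iff_affineSpan_eq_top, eq_top_iff]
  intro x _
  cases K with
  | triangle a b c pos =>
    refine affineSpan_mono ℝ ?_ (mem_affineSpan_triple pos.ne' a x)
    rw [add_sub_cancel, add_sub_cancel]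
    rintro _ (rfl | rfl | rfl)
    · exact ⟨(0 : Fin 3), rfl⟩
    · exact ⟨(1 : Fin 3), rfl⟩
    · exact ⟨(2 : Fin 3), rfl⟩
  | rectangle a u v orth pos =>
    refine affineSpan_mono ℝ ?_ (mem_affineSpan_triple pos.ne' a x)
    rintro _ (rfl | rfl | rfl)
    · exact ⟨(0 : Fin 4), rfl⟩
    · exact ⟨(1 : Fin 4), rfl⟩
    · exact ⟨(3 : Fin 4), rfl⟩

end Cell

/-- A polynomial that vanishes on a nonempty open set of the plane is zero. -/
theorem eq_zero_of_eval_eq_zero_on_open {O : Set Plane} (hO : IsOpen O) (hne : O.Nonempty)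
    {p : MvPolynomial (Fin 2) ℝ} (hp : ∀ x ∈ O, eval (fun c => x c) p = 0) : p = 0 := by
  obtain ⟨y, hy⟩ := hne
  have hO' : IsOpen ((WithLp.toLp 2 : (Fin 2 → ℝ) → Plane) ⁻¹' O) :=
    hO.preimage (PiLp.continuous_toLp 2 _)
  obtain ⟨ε, hε, hball⟩ := Metric.isOpen_iff.1 hO' (fun c => y c) hy
  -- A ball in the sup norm is a product of intervals, and a polynomial that vanishes on a product
  -- of infinite sets is zero.
  refine funext_set (fun c => Metric.ball (y c) ε) (fun c => ?_) fun x hx => ?_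
  · rw [Real.ball_eq_Ioo]
    exact Set.Ioo_infinite (by linarith)
  · have : x ∈ Metric.ball (fun c => y c) ε := by
      rw [ball_pi _ hε]
      exact hx
    simpa using hp _ (hball this)

namespace Discretization

variable {Ω : Set Plane} (D : Discretization Ω)

/-- The cells cover only the closure of `Ω`. Convexity excludes slits: an open convex set is the
interior of its closure. -/
theorem interior_carrier_subset (ho : IsOpen Ω) (hne : Ω.Nonempty) (hc : Convex ℝ Ω)
    (i : Fin D.numCells) : interior (D.cell i).carrier ⊆ Ω := by
  have h : (D.cell i).carrier ⊆ closure Ω := by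
    rw [← D.iUnion_carrier]
    exact Set.subset_iUnion (fun i => (D.cell i).carrier) i
  have h' := hc.interior_closure_eq_interior_of_nonempty_interior (by rwa [ho.interior_eq])
  rw [ho.interior_eq] at h'
  exact (interior_mono h).trans h'.subset

theorem val_of_mem_interior (v : D.Broken) {i : Fin D.numCells} {x : Plane}
    (hx : x ∈ interior (D.cell i).carrier) : D.val v x = eval (fun c => x c) (v i) := by
  unfold val
  rw [Finset.sum_eq_single i (fun j _ hj => ?_) (by simp)]
  · rw [Set.indicator_of_mem hx]
  · exact Set.indicator_of_notMem
      (fun hx' => Set.disjoint_left.1 (D.disjoint_interior j i hj) hx' hx) _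

theorem eq_zero_of_integral_val_sq (ho : IsOpen Ω) (hne : Ω.Nonempty) (hc : Convex ℝ Ω)
    (hΩ : volume Ω ≠ ⊤) (v : D.Broken) (h : ∫ x in Ω, D.val v x ^ 2 = 0) : v = 0 := by
  funext i
  have hae := (setIntegral_eq_zero_iff_of_nonneg_ae (.of_forall fun x => sq_nonneg _)
    (D.memLp_val hΩ v).integrable_sq).1 h
  have hae' : ∀ᵐ x ∂volume.restrict (interior (D.cell i).carrier), D.val v x ^ 2 = 0 :=
    ae_restrict_of_ae_restrict_of_subset (D.interior_carrier_subset ho hne hc i) hae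
  refine eq_zero_of_eval_eq_zero_on_open isOpen_interior (D.cell i).interior_carrier_nonempty ?_
  have heq : (fun x : Plane => eval (fun c => x c) (v i))
      =ᵐ[volume.restrict (interior (D.cell i).carrier)] fun _ => 0 := by
    filter_upwards [hae', ae_restrict_mem isOpen_interior.measurableSet] with x hx hxi
    rw [← D.val_of_mem_interior v hxi]
    exact pow_eq_zero_iff two_ne_zero |>.1 hx
  exact Measure.eqOn_open_of_ae_eq heq isOpen_interior
    (continuous_eval_plane _).continuousOn continuousOn_const

instance finiteDimensional_polySpace (K : Cell) (p : ℕ) :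
    FiniteDimensional ℝ (K.polySpace p) := by
  cases K <;> unfold Cell.polySpace <;> infer_instance

theorem finiteDimensional_pi {ι M : Type*} [Finite ι] [AddCommGroup M] [Module ℝ M]
    (S : ι → Submodule ℝ M) [∀ i, FiniteDimensional ℝ (S i)] :
    FiniteDimensional ℝ (Submodule.pi Set.univ S) := by
  let f : Submodule.pi Set.univ S →ₗ[ℝ] ∀ i, S i :=
    LinearMap.pi fun i => ((LinearMap.proj i).comp (Submodule.pi Set.univ S).subtype).codRestrict
      (S i) fun x => x.2 i (Set.mem_univ i)
  refine FiniteDimensional.of_injective f fun x y hxy => Subtype.ext (funext fun i => ?_)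
  exact congrArg Subtype.val (congrFun hxy i)

instance finiteDimensional_V : FiniteDimensional ℝ D.V := finiteDimensional_pi _

instance finiteDimensional_W : FiniteDimensional ℝ D.W := finiteDimensional_pi _

theorem abs_le_dualNormV (ho : IsOpen Ω) (hne : Ω.Nonempty) (hc : Convex ℝ Ω)
    (hΩ : volume Ω ≠ ⊤) (F : D.V →ₗ[ℝ] ℝ) (v : D.V) : |F v| ≤ D.dualNormV F * D.normV v :=
  abs_le_iSup_div_mul ((D.l2Form hΩ).domRestrict₁₂ D.V D.V) (fun v w => D.l2Inner_comm v w)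
    (fun v => (integral_nonneg fun x => mul_self_nonneg _ : 0 ≤ D.l2Inner (D.val v) v))
    (fun v (h : D.l2Inner (D.val v) v = 0) => Subtype.ext
      (D.eq_zero_of_integral_val_sq ho hne hc hΩ v (by rwa [l2Inner_self] at h))) F v

theorem abs_le_dualNormW (ho : IsOpen Ω) (hne : Ω.Nonempty) (hc : Convex ℝ Ω)
    (hΩ : volume Ω ≠ ⊤) (G : D.W →ₗ[ℝ] ℝ) (w : D.W) : |G w| ≤ D.dualNormW G * D.normW w := by
  have hb : ∀ p w, D.weightedForm hΩ ho.measurableSet boundedField_one p w = D.formA p w :=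
    fun p w => (D.formA_eq_weighted p w).symm
  have h := abs_le_iSup_div_mul
    ((D.weightedForm hΩ ho.measurableSet boundedField_one).domRestrict₁₂ D.W D.W)
    (fun v w => by
      simp only [LinearMap.domRestrict₁₂_apply, hb, formA, dotProduct_comm])
    (fun v => by
      simp only [LinearMap.domRestrict₁₂_apply, hb, D.formA_self hΩ]
      exact Finset.sum_nonneg fun i _ => integral_nonneg fun x => sq_nonneg _)
    (fun v h => by
      simp only [LinearMap.domRestrict₁₂_apply, hb, D.formA_self hΩ] at h
      rw [Finset.sum_eq_zero_iff_of_nonneg fun i _ => integral_nonneg fun x => sq_nonneg _] at h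
      exact Subtype.ext (funext fun c =>
        D.eq_zero_of_integral_val_sq ho hne hc hΩ _ (h c (Finset.mem_univ c)))) G w
  simp only [LinearMap.domRestrict₁₂_apply, hb] at h
  exact h

end Discretization

/-! ### The memory term -/

/-- Convexity is what the mean value inequality for the derivative within this set requires. -/
theorem convex_memDomain {Ω : Set Plane} (hc : Convex ℝ Ω) (T : ℝ) : Convex ℝ (memDomain Ω T) := by
  rintro ⟨x, t, s⟩ ⟨hx, hs, hst, ht⟩ ⟨x', t', s'⟩ ⟨hx', hs', hst', ht'⟩ a b ha hb hab
  simp only at hx hs hst ht hx' hs' hst' ht'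
  refine ⟨hc hx hx' ha hb hab, ?_, ?_, ?_⟩ <;>
    simp only [Prod.smul_mk, Prod.mk_add_mk, smul_eq_mul]
  · positivity
  · gcongr
  · calc a * t + b * t' ≤ a * T + b * T := by gcongr
      _ = T := by rw [← add_mul, hab, one_mul]

namespace CoeffBounds

variable {Ω : Set Plane} {T α M : ℝ} {A : Plane → Matrix (Fin 2) (Fin 2) ℝ}
  {B : Plane → ℝ → ℝ → Matrix (Fin 2) (Fin 2) ℝ}

theorem boundedField_A (h : CoeffBounds Ω T α M A B) (hm : MeasurableSet Ω) :
    BoundedField Ω A M := fun i j =>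
  ⟨(h.contDiffOn_A i j).continuousOn.aestronglyMeasurable hm, h.bound_A i j⟩

theorem boundedField_B (h : CoeffBounds Ω T α M A B) (hm : MeasurableSet Ω) {t s : ℝ}
    (hs : 0 ≤ s) (hst : s ≤ t) (ht : t ≤ T) : BoundedField Ω (fun x => B x t s) M := fun i j => by
  refine ⟨ContinuousOn.aestronglyMeasurable ?_ hm,
    fun x hx => h.bound_B i j (x, t, s) ⟨hx, hs, hst, ht⟩⟩
  exact (h.contDiffOn_B i j).continuousOn.comp (f := fun x : Plane => (x, t, s))
    (by fun_prop) fun x hx => ⟨hx, hs, hst, ht⟩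

/-- Mean value inequality along a segment in the `t` direction, whose length in the product norm is
`t' - t`. -/
theorem boundedField_B_sub (h : CoeffBounds Ω T α M A B) (hm : MeasurableSet Ω)
    (hc : Convex ℝ Ω) {t t' s : ℝ} (hs : 0 ≤ s) (hst : s ≤ t) (htt : t ≤ t') (ht : t' ≤ T) :
    BoundedField Ω (fun x => B x t' s - B x t s) (M * (t' - t)) := by
  refine (h.boundedField_B hm hs (hst.trans htt) ht).sub
    (h.boundedField_B hm hs hst (htt.trans ht)) fun i j x hx => ?_
  have := (convex_memDomain hc T).norm_image_sub_le_of_norm_fderivWithin_le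
    ((h.contDiffOn_B i j).differentiableOn one_ne_zero) (h.bound_deriv_B i j)
    (x := (x, t, s)) (y := (x, t', s)) ⟨hx, hs, hst, htt.trans ht⟩ ⟨hx, hs, hst.trans htt, ht⟩
  have hn : ‖((x, t', s) : Plane × ℝ × ℝ) - (x, t, s)‖ = t' - t := by
    simp [Prod.norm_def, abs_of_nonneg (sub_nonneg.2 htt), htt]
  rwa [hn] at this

end CoeffBounds

namespace Discretization

variable {Ω : Set Plane} (D : Discretization Ω) {T α M : ℝ}
  {A : Plane → Matrix (Fin 2) (Fin 2) ℝ} {B : Plane → ℝ → ℝ → Matrix (Fin 2) (Fin 2) ℝ}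

theorem weighted_sub {S S' : Plane → Matrix (Fin 2) (Fin 2) ℝ} {c c' : ℝ} (hΩ : volume Ω ≠ ⊤)
    (hm : MeasurableSet Ω) (hS : BoundedField Ω S c) (hS' : BoundedField Ω S' c')
    (p w : Fin 2 → D.Broken) :
    D.weighted (fun x => S x - S' x) p w = D.weighted S p w - D.weighted S' p w := by
  have hd : BoundedField Ω (fun x => S x - S' x) (c + c') := hS.sub hS' fun i j x hx =>
    (abs_sub _ _).trans (add_le_add ((hS i j).2 x hx) ((hS' i j).2 x hx))
  rw [D.weighted_eq_sum hΩ hm hS, D.weighted_eq_sum hΩ hm hS', D.weighted_eq_sum hΩ hm hd]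
  simp only [← Finset.sum_sub_distrib]
  refine Finset.sum_congr rfl fun i _ => Finset.sum_congr rfl fun j _ => ?_
  rw [← integral_sub (D.integrable_weighted hΩ hm hS _ _ _ _)
    (D.integrable_weighted hΩ hm hS' _ _ _ _)]
  simp only [Matrix.sub_apply, sub_mul]

theorem midpoint_mem {k : ℝ} (hk : 0 ≤ k) {j n : ℕ} (hj : j < n) :
    0 ≤ ((j : ℝ) + 1 / 2) * k ∧ ((j : ℝ) + 1 / 2) * k ≤ n * k := by
  have : (j : ℝ) + 1 ≤ n := by exact_mod_cast hj
  exact ⟨by positivity, mul_le_mul_of_nonneg_right (by linarith) hk⟩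

theorem exists_memory_eq (hΩ : volume Ω ≠ ⊤) (hm : MeasurableSet Ω)
    (h : CoeffBounds Ω T α M A B) {k : ℝ} (hk : 0 ≤ k) (Q : ℕ → D.W) {n : ℕ} (hn : n * k ≤ T) :
    ∃ E : D.W →ₗ[ℝ] ℝ, ∀ τ : D.W, E τ = D.memory B k Q τ n := by
  have hB : ∀ j : Fin n, BoundedField Ω (fun x => B x (n * k) (((j : ℕ) + 1 / 2) * k)) M :=
    fun j => h.boundedField_B hm (midpoint_mem hk j.2).1 (midpoint_mem hk j.2).2 hn
  refine ⟨k • ∑ j : Fin n, (D.weightedForm hΩ hm (hB j) (half Q j : D.W)).comp D.W.subtype,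
    fun τ => ?_⟩
  simp only [LinearMap.smul_apply, LinearMap.sum_apply, LinearMap.comp_apply,
    Submodule.subtype_apply, smul_eq_mul, memory, Finset.sum_range]
  rfl

theorem dualNormV_nonneg (F : D.V →ₗ[ℝ] ℝ) : 0 ≤ D.dualNormV F :=
  Real.iSup_nonneg fun _ => div_nonneg (abs_nonneg _) (Real.sqrt_nonneg _)

theorem dualNormW_nonneg (G : D.W →ₗ[ℝ] ℝ) : 0 ≤ D.dualNormW G :=
  Real.iSup_nonneg fun _ => div_nonneg (abs_nonneg _) (Real.sqrt_nonneg _)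

theorem normW_nonneg (w : Fin 2 → D.Broken) : 0 ≤ D.normW w := Real.sqrt_nonneg _

/-- The new memory term has one more node, of weight `k`, and at each old node the kernel changes
only by the step from `t_n` to `t_{n+1}`. That change is at most `M * k` per entry, which gives the
second factor `k`. -/
theorem abs_memory_succ_sub_le (hΩ : volume Ω ≠ ⊤) (hm : MeasurableSet Ω) (hc : Convex ℝ Ω)
    (h : CoeffBounds Ω T α M A B) (hM : 0 ≤ M) {k : ℝ} (hk : 0 ≤ k) (Q : ℕ → D.W) {n : ℕ}
    (hn : (n + 1) * k ≤ T) (τ : D.W) :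
    |D.memory B k Q τ (n + 1) - D.memory B k Q τ n| ≤ 4 * M * k * (D.normW (half Q n : D.W)
      + k * ∑ j ∈ Finset.range n, D.normW (half Q j : D.W)) * D.normW τ := by
  have hn' : ((n + 1 : ℕ) : ℝ) * k ≤ T := by push_cast; exact hn
  have hnn : (n : ℝ) * k ≤ ((n + 1 : ℕ) : ℝ) * k := by
    push_cast; linarith
  have hlast := D.abs_weighted_le hΩ hm (h.boundedField_B hm
    (midpoint_mem hk n.lt_succ_self).1 (midpoint_mem hk n.lt_succ_self).2 hn') hM
    (half Q n : D.W) τ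
  have hdiff : ∀ j ∈ Finset.range n,
      |D.weighted (fun x => B x ((n + 1 : ℕ) * k) ((j + 1 / 2) * k)) (half Q j : D.W) τ
        - D.weighted (fun x => B x (n * k) ((j + 1 / 2) * k)) (half Q j : D.W) τ|
      ≤ 4 * (M * k) * (D.normW (half Q j : D.W) * D.normW τ) := by
    intro j hj
    have hj' := midpoint_mem hk (Finset.mem_range.1 hj)
    have hsub := h.boundedField_B_sub hm hc hj'.1 hj'.2 hnn hn'
    rw [show ((n + 1 : ℕ) : ℝ) * k - n * k = k by push_cast; ring] at hsub
    rw [← D.weighted_sub hΩ hm (h.boundedField_B hm hj'.1 (hj'.2.trans hnn) hn')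
      (h.boundedField_B hm hj'.1 hj'.2 (hnn.trans hn'))]
    exact D.abs_weighted_le hΩ hm hsub (by positivity) _ _
  have hsum := (Finset.abs_sum_le_sum_abs _ _).trans (Finset.sum_le_sum hdiff)
  rw [Finset.sum_sub_distrib, ← Finset.mul_sum, ← Finset.sum_mul] at hsum
  unfold memory
  rw [Finset.sum_range_succ, ← mul_sub, abs_mul, abs_of_nonneg hk]
  calc _ ≤ k * (4 * (M * k) * ((∑ j ∈ Finset.range n, D.normW (half Q j : D.W)) * D.normW τ)
        + 4 * M * (D.normW (half Q n : D.W) * D.normW τ)) := by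
        refine mul_le_mul_of_nonneg_left ?_ hk
        rw [add_sub_right_comm]
        exact (abs_add_le _ _).trans (add_le_add hsum hlast)
    _ = _ := by ring

theorem normW_le_of_coercive (hΩ : volume Ω ≠ ⊤) (hm : MeasurableSet Ω)
    (h : CoeffBounds Ω T α M A B) (hα : 0 < α) (w : Fin 2 → D.Broken) :
    D.normW w ≤ (√α)⁻¹ * √(D.weighted A w w) := by
  have hle := D.mul_formA_self_le_weighted hΩ hm (h.boundedField_A hm) h.coercive w
  rw [inv_mul_eq_div, le_div_iff₀ (Real.sqrt_pos.2 hα), mul_comm, normW, ← Real.sqrt_mul hα.le]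
  exact Real.sqrt_le_sqrt hle

theorem weighted_self_nonneg (hm : MeasurableSet Ω) (h : CoeffBounds Ω T α M A B) (hα : 0 ≤ α)
    (w : Fin 2 → D.Broken) : 0 ≤ D.weighted A w w :=
  setIntegral_nonneg hm fun x hx => (mul_nonneg hα (Finset.sum_nonneg fun _ _ =>
    mul_self_nonneg _)).trans (h.coercive x hx (D.vecVal w x))

end Discretization

/-! ### Time averages of the source, and assembly of the estimate -/

theorem l2Norm_nonneg (Ω : Set Plane) (g : Plane → ℝ) : 0 ≤ l2Norm Ω g := Real.sqrt_nonneg _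

theorem memLp_quarter {Ω : Set Plane} {φ : ℕ → Plane → ℝ} {n : ℕ}
    (hφ : ∀ i ≤ n + 2, MemLp (φ i) 2 (volume.restrict Ω)) :
    MemLp (quarter φ (n + 1)) 2 (volume.restrict Ω) :=
  (((hφ (n + 2) le_rfl).add ((hφ (n + 1) (by omega)).const_smul (2 : ℝ))).add
    (hφ n (by omega))).const_smul (1 / 4 : ℝ)

theorem l2Norm_quarter_le {Ω : Set Plane} {φ : ℕ → Plane → ℝ} {n : ℕ}
    (hφ : ∀ i ≤ n + 2, MemLp (φ i) 2 (volume.restrict Ω)) :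
    l2Norm Ω (quarter φ (n + 1)) ≤ 1 / 4 * (l2Norm Ω (φ (n + 2)) + 2 * l2Norm Ω (φ (n + 1))
      + l2Norm Ω (φ n)) := by
  have h1 := (hφ (n + 1) (by omega)).const_smul (2 : ℝ)
  have h2 := hφ (n + 2) le_rfl
  have h3 := l2Norm_add_le (h2.add h1) (hφ n (by omega))
  have h4 := l2Norm_add_le h2 h1
  rw [l2Norm_smul, abs_of_pos two_pos] at h4
  have e : quarter φ (n + 1) = (1 / 4 : ℝ) • (φ (n + 2) + (2 : ℝ) • φ (n + 1) + φ n) := rfl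
  rw [e, l2Norm_smul, abs_of_pos (by norm_num)]
  linarith

theorem sum_l2Norm_quarter_le {Ω : Set Plane} {φ : ℕ → Plane → ℝ} {m : ℕ}
    (hφ : ∀ i ≤ m + 1, MemLp (φ i) 2 (volume.restrict Ω)) :
    ∑ n ∈ Finset.range m, l2Norm Ω (quarter φ (n + 1))
      ≤ ∑ n ∈ Finset.range (m + 2), l2Norm Ω (φ n) := by
  have hshift : ∀ c ≤ 2, ∑ i ∈ Finset.range m, l2Norm Ω (φ (i + c))
      ≤ ∑ n ∈ Finset.range (m + 2), l2Norm Ω (φ n) := by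
    intro c hc
    rw [Finset.range_eq_Ico, Finset.sum_Ico_add' (fun i => l2Norm Ω (φ i)) 0 m c]
    refine Finset.sum_le_sum_of_subset_of_nonneg (fun x hx => ?_) fun _ _ _ => l2Norm_nonneg _ _
    simp only [Finset.mem_Ico, Finset.mem_range] at hx ⊢
    omega
  refine (Finset.sum_le_sum fun n hn => l2Norm_quarter_le fun i hi => hφ i ?_).trans ?_
  · have := Finset.mem_range.1 hn
    omega
  · rw [← Finset.mul_sum, Finset.sum_add_distrib, Finset.sum_add_distrib, ← Finset.mul_sum]
    have h0 := hshift 0 (by omega)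
    have h1 := hshift 1 (by omega)
    have h2 := hshift 2 le_rfl
    simp only [add_zero] at h0
    linarith

/-- This is `energy_stability` on the finite element spaces, with `H = G - E`, `c = 1/√α` from
coercivity and `β = 4 M` from the memory increment. -/
theorem energyNorm_le {T α M : ℝ} (hT : 0 < T) (hα : 0 < α) (hM : 0 < M)
    {Ω : Set Plane} (ho : IsOpen Ω) (hne : Ω.Nonempty) (hb : Bornology.IsBounded Ω)
    (hc : Convex ℝ Ω) {A : Plane → Matrix (Fin 2) (Fin 2) ℝ}
    {B : Plane → ℝ → ℝ → Matrix (Fin 2) (Fin 2) ℝ} (hAB : CoeffBounds Ω T α M A B)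
    (D : Discretization Ω) {N : ℕ} {k : ℝ} (hk : 0 < k) (hkN : N * k = T)
    (hkγ : 6 * (√α)⁻¹ ^ 2 * (4 * M) * (1 + T) * k ≤ 1 / 2) {φ : ℕ → Plane → ℝ}
    (hφ : ∀ n ≤ N, MemLp (φ n) 2 (volume.restrict Ω)) {F : ℕ → D.V →ₗ[ℝ] ℝ}
    {G : ℕ → D.W →ₗ[ℝ] ℝ} (hG : G 0 = 0) {U : ℕ → D.V} {Q Z : ℕ → D.W}
    (hsol : D.IsSolution A B k N φ F G U Q Z) {m : ℕ} (hmN : m + 1 ≤ N) :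
    D.energyNorm A k U Q Z m ≤ 2 * Real.exp (2 * (6 * (√α)⁻¹ ^ 2 * (4 * M) * (1 + T)) * T) *
      (D.energyNorm A k U Q Z 0 + (2 * (k * ∑ n ∈ Finset.range m,
          (l2Norm Ω (quarter φ (n + 1)) + D.dualNormV (F (n + 1))))
        + 6 * (√α)⁻¹ * (k * ∑ n ∈ Finset.range (m + 1), D.dualNormW (dt k G n)))) := by
  have hm := ho.measurableSet
  have hΩ : volume Ω ≠ ⊤ := hb.measure_lt_top.ne
  have hmT : ((m : ℝ) + 1) * k ≤ T := by
    rw [← hkN]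
    exact mul_le_mul_of_nonneg_right (by exact_mod_cast hmN) hk.le
  have hnT : ∀ n ≤ N, (n : ℝ) * k ≤ T := fun n hn => by
    rw [← hkN]
    exact mul_le_mul_of_nonneg_right (by exact_mod_cast hn) hk.le
  -- the memory terms and the sources as linear functionals
  have hE : ∀ n, ∃ E : D.W →ₗ[ℝ] ℝ, n ≤ N → ∀ τ : D.W, E τ = D.memory B k Q τ n := fun n => by
    by_cases hn : n ≤ N
    · obtain ⟨E, hE⟩ := D.exists_memory_eq hΩ hm hAB hk.le Q (hnT n hn)
      exact ⟨E, fun _ => hE⟩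
    · exact ⟨0, fun h => absurd h hn⟩
  choose E hE using hE
  have hR : ∀ n, ∃ R : D.V →ₗ[ℝ] ℝ, n < N → 1 ≤ n → ∀ v : D.V,
      R v = D.l2Inner (quarter φ n) v + F n v := fun n => by
    by_cases hn : n < N ∧ 1 ≤ n
    · obtain ⟨p, rfl⟩ : ∃ p, n = p + 1 := ⟨n - 1, by omega⟩
      exact ⟨(D.l2Functional hΩ (memLp_quarter fun i hi => hφ i (by omega))).comp D.V.subtype
        + F (p + 1), fun _ _ _ => rfl⟩
    · exact ⟨0, fun h h' => absurd ⟨h, h'⟩ hn⟩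
  choose R hR using hR
  have l2_nonneg : ∀ v : D.Broken, 0 ≤ D.l2Inner (D.val v) v := fun v =>
    integral_nonneg fun x => mul_self_nonneg _
  have hone : ∀ p w, D.weightedForm hΩ hm Discretization.boundedField_one p w = D.formA p w :=
    fun p w => (D.formA_eq_weighted p w).symm
  have key := energy_stability ((D.l2Form hΩ).domRestrict₁₂ D.V D.V)
    (D.bilinJ.domRestrict₁₂ D.V D.V)
    ((D.weightedForm hΩ hm Discretization.boundedField_one).domRestrict₁₂ D.W D.W)
    ((D.weightedForm hΩ hm (hAB.boundedField_A hm)).domRestrict₁₂ D.W D.W)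
    (D.bilinJ1.domRestrict₁₂ D.W D.W) (D.bilinA1.domRestrict₁₂ D.V D.W)
    (fun v w => D.l2Inner_comm v w) (fun v w => D.formJ_comm v w)
    (fun p w => by
      simp only [LinearMap.domRestrict₁₂_apply, hone, Discretization.formA, dotProduct_comm])
    (fun p w => D.weighted_comm hm hAB.symm p w) (fun p w => D.formJ1_comm p w)
    (fun v => l2_nonneg v) (fun v => D.formJ_self_nonneg v)
    (fun w => D.weighted_self_nonneg hm hAB hα.le w) (fun w => D.formJ1_self_nonneg w)
    (fun w => D.normW w) (c := (√α)⁻¹) (by positivity) (fun w => D.normW_nonneg w)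
    (fun w => D.normW_le_of_coercive hΩ hm hAB hα w) hk hT.le (β := 4 * M) (by positivity) hkγ m
    hmT U Q Z (fun n => G n - E n) R
    (fun n => l2Norm Ω (quarter φ n) + D.dualNormV (F n)) (fun n => D.dualNormW (dt k G n))
    (fun n => add_nonneg (l2Norm_nonneg _ _) (D.dualNormV_nonneg _)) (fun n => D.dualNormW_nonneg _)
    -- `H 0 = 0`: `G 0` vanishes by hypothesis, and the memory sum at level 0 is empty.
    (by
      ext τ
      simp [hG, hE 0 (Nat.zero_le N), Discretization.memory])
    (fun n hn w => by
      simp only [LinearMap.domRestrict₁₂_apply, hone]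
      exact hsol.gradient_eq n (by omega) w)
    (fun n hn τ => by
      have := hsol.flux_eq n (by omega) τ
      simp only [LinearMap.domRestrict₁₂_apply, hone]
      simp only [half, smul_eq_mul, LinearMap.smul_apply, LinearMap.add_apply,
        LinearMap.sub_apply, hE n (by omega), hE (n + 1) (by omega)] at this ⊢
      refine (?_ : D.weighted A _ _ - _ = _)
      linarith)
    (fun n hn v => by
      rw [hR (n + 1) (by omega) (by omega)]
      exact hsol.motion_eq (n + 1) (by omega) (by omega) v)
    (fun n hn v => by
      rw [hR (n + 1) (by omega) (by omega), add_mul]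
      exact (abs_add_le _ _).trans (add_le_add
        (D.abs_l2Inner_le hΩ (memLp_quarter fun i hi => hφ i (by omega)) v)
        (D.abs_le_dualNormV ho hne hc hΩ (F (n + 1)) v)))
    (fun n hn τ => by
      have h1 := D.abs_memory_succ_sub_le hΩ hm hc hAB hM.le hk.le Q (n := n)
        (by simpa using hnT (n + 1) (by omega)) τ
      have h2 := mul_le_mul_of_nonneg_left
        (D.abs_le_dualNormW ho hne hc hΩ (dt k G n) τ) hk.le
      have e : G (n + 1) τ - G n τ = k * dt k G n τ := by
        simp only [dt, LinearMap.smul_apply, LinearMap.sub_apply, smul_eq_mul]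
        field_simp
      simp only [LinearMap.sub_apply, hE n (by omega), hE (n + 1) (by omega)]
      rw [sub_sub_sub_comm, e, add_mul]
      refine (abs_sub _ _).trans (add_le_add ?_ h1)
      rw [abs_mul, abs_of_pos hk, mul_assoc]
      exact h2)
  unfold Discretization.energyNorm Discretization.normV
  rw [Real.sq_sqrt (l2_nonneg _), Real.sq_sqrt (l2_nonneg _)]
  exact key

end DGWave

open DGWave in
theorem theorem6p1 (T α M : ℝ) (hT : 0 < T) (hα : 0 < α) (hM : 0 < M) :
    ∃ C k₀ : ℝ, 0 < C ∧ 0 < k₀ ∧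
      ∀ (Ω : Set DGWave.Plane), IsOpen Ω → Ω.Nonempty → Bornology.IsBounded Ω → Convex ℝ Ω →
      ∀ (A : DGWave.Plane → Matrix (Fin 2) (Fin 2) ℝ)
        (B : DGWave.Plane → ℝ → ℝ → Matrix (Fin 2) (Fin 2) ℝ),
        DGWave.CoeffBounds Ω T α M A B →
      ∀ (D : DGWave.Discretization Ω) (N : ℕ) (k : ℝ),
        0 < N → k = T / N → k ≤ k₀ →
      ∀ f : ℝ → DGWave.Plane → ℝ,
        (∀ t ∈ Set.Icc 0 T, MeasureTheory.MemLp (f t) 2 (MeasureTheory.volume.restrict Ω)) →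
      ∀ (F : ℕ → D.V →ₗ[ℝ] ℝ) (G : ℕ → D.W →ₗ[ℝ] ℝ), G 0 = 0 →
      ∀ (U : ℕ → D.V) (Q Z : ℕ → D.W),
        D.IsSolution A B k N (fun n => f (n * k)) F G U Q Z →
      ∀ m : ℕ, 1 ≤ m → m + 1 ≤ N →
        D.energyNorm A k U Q Z m ≤
          C * (D.energyNorm A k U Q Z 0
            + k * ∑ n ∈ Finset.range (m + 2), DGWave.l2Norm Ω (f (n * k))
            + k * ∑ n ∈ Finset.Icc 1 m, D.dualNormV (F n)
            + k * ∑ n ∈ Finset.range (m + 1), D.dualNormW (DGWave.dt k G n)) := by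
  set c : ℝ := (√α)⁻¹ with hc
  have hc0 : 0 < c := by positivity
  set γ : ℝ := 6 * c ^ 2 * (4 * M) * (1 + T) with hγ
  have hγ0 : 0 < γ := by positivity
  -- `k ≤ 1 / (2 * γ)` is the smallness needed for absorption. The factor `2 + 6 * c` dominates the
  -- coefficients 1, 2 and `6 * c` of the initial energy, the sources and the flux perturbation.
  refine ⟨2 * Real.exp (2 * γ * T) * (2 + 6 * c), 1 / (2 * γ), by positivity, by positivity, ?_⟩
  intro Ω ho hne hb hconv A B hAB D N k hN hkN hk f hf F G hG U Q Z hsol m _ hmN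
  have hN' : (0 : ℝ) < N := by exact_mod_cast hN
  have hk0 : 0 < k := by rw [hkN]; positivity
  have hNk : N * k = T := by rw [hkN]; field_simp
  have hφ : ∀ n ≤ N, MemLp (f (n * k)) 2 (volume.restrict Ω) := fun n hn => by
    refine hf _ ⟨by positivity, ?_⟩
    rw [← hNk]
    exact mul_le_mul_of_nonneg_right (by exact_mod_cast hn) hk0.le
  have hkγ : γ * k ≤ 1 / 2 := by
    calc γ * k ≤ γ * (1 / (2 * γ)) := mul_le_mul_of_nonneg_left hk hγ0.le
      _ = 1 / 2 := by field_simp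
  have key := energyNorm_le hT hα hM ho hne hb hconv hAB D hk0 hNk hkγ
    (φ := fun n => f (n * k)) hφ hG hsol hmN
  have hsumf := mul_le_mul_of_nonneg_left (sum_l2Norm_quarter_le (φ := fun n : ℕ => f (n * k))
    (m := m) fun i hi => hφ i (by omega)) hk0.le
  have hF : ∑ n ∈ Finset.range m, D.dualNormV (F (n + 1))
      = ∑ n ∈ Finset.Icc 1 m, D.dualNormV (F n) := by
    rw [Finset.range_eq_Ico, Finset.sum_Ico_add' (fun n => D.dualNormV (F n)) 0 m 1]
    rfl
  rw [Finset.sum_add_distrib, hF, mul_add k, ← hc, ← hγ] at key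
  refine key.trans ?_
  rw [mul_assoc (2 * Real.exp (2 * γ * T))]
  have hexp : 0 ≤ 2 * Real.exp (2 * γ * T) := by positivity
  refine mul_le_mul_of_nonneg_left ?_ hexp
  have h0 : 0 ≤ D.energyNorm A k U Q Z 0 := Real.sqrt_nonneg _
  have h1 : 0 ≤ k * ∑ n ∈ Finset.range (m + 2), l2Norm Ω (f (n * k)) :=
    mul_nonneg hk0.le (Finset.sum_nonneg fun _ _ => l2Norm_nonneg _ _)
  have h2 : 0 ≤ k * ∑ n ∈ Finset.Icc 1 m, D.dualNormV (F n) :=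
    mul_nonneg hk0.le (Finset.sum_nonneg fun n _ => D.dualNormV_nonneg _)
  have h3 : 0 ≤ k * ∑ n ∈ Finset.range (m + 1), D.dualNormW (dt k G n) :=
    mul_nonneg hk0.le (Finset.sum_nonneg fun n _ => D.dualNormW_nonneg _)
  have g0 := mul_nonneg hc0.le h0
  have g1 := mul_nonneg hc0.le h1
  have g2 := mul_nonneg hc0.le h2
  have g3 := mul_nonneg hc0.le h3
  linarith
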